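/- Let $p>2$ be a prime, let $r\ge 1$ be an integer and put $q=p^r$. Let $\mathcal J$ be the Nottingham group over $\mathbb F_p$, that is, the group of formal power series $t+\sum_{k\ge 1}a_kt^{k+1}$ with $a_k\in\mathbb F_p$ under substitution, with the topology of coefficientwise convergence, and let $T=T(r)$ be its closed subgroup (the Fesenko group) $$T(r)=\Bigl\{\,t+\sum_{k\ge 1}a_{qk+1}t^{qk+1} : a_{qk+1}\in\mathbb F_p\Bigr\}.$$ Then $T$ has finite width: if $\gamma_1(T)=T$ and $\gamma_{n+1}(T)=[\gamma_n(T),T]$ denotes the lower central series, there is a constant $C$ (which may depend on $p$ and $r$, but not on $n$) such that all indices are finite and $$|\gamma_n(T):\gamma_{n+1}(T)|\le C\qquad\text{for all } n\ge 1.$$ This holds both for the lower central series in the topological sense, where $[\gamma_n(T),T]$ is the closed subgroup generated by the commutators, and for the abstract lower central series. -/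

import Mathlib

noncomputable section

open scoped PowerSeries.WithPiTopology

/-- The underlying set of the Nottingham group over `𝔽_p`: the formal power series
`t + a₁ t² + a₂ t³ + ⋯` with coefficients in `ZMod p`. -/
def Nottingham (p : ℕ) : Type :=
  {f : PowerSeries (ZMod p) // PowerSeries.constantCoeff f = 0 ∧ PowerSeries.coeff 1 f = 1}

namespace Nottingham

variable {p : ℕ}

/-- The power series underlying an element of the Nottingham group. -/
def toSeries (f : Nottingham p) : PowerSeries (ZMod p) := f.1

theorem ext_series {f g : Nottingham p} (h : f.toSeries = g.toSeries) : f = g := Subtype.ext h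

theorem constantCoeff_toSeries (f : Nottingham p) :
    PowerSeries.constantCoeff f.toSeries = 0 := f.2.1

theorem coeff_one_toSeries (f : Nottingham p) : PowerSeries.coeff 1 f.toSeries = 1 := f.2.2

theorem hasSubst (f : Nottingham p) : PowerSeries.HasSubst f.toSeries :=
  PowerSeries.HasSubst.of_constantCoeff_zero' f.constantCoeff_toSeries

theorem isUnit_coeff_one (f : Nottingham p) : IsUnit (PowerSeries.coeff 1 f.toSeries) := by
  rw [f.coeff_one_toSeries]; exact isUnit_one

theorem coeff_pow_eq_zero {g : PowerSeries (ZMod p)} (hg : PowerSeries.constantCoeff g = 0)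
    {d n : ℕ} (h : n < d) : PowerSeries.coeff n (g ^ d) = 0 := by
  have h1 : PowerSeries.X ^ d ∣ g ^ d := pow_dvd_pow_of_dvd (PowerSeries.X_dvd_iff.2 hg) d
  exact PowerSeries.X_pow_dvd_iff.1 h1 n h

/-- The coefficients of a composite `f(g(t))` are given by the expected finite sums. -/
theorem coeff_subst_eq_sum {g : PowerSeries (ZMod p)} (hg : PowerSeries.constantCoeff g = 0)
    (f : PowerSeries (ZMod p)) (n : ℕ) :
    PowerSeries.coeff n (f.subst g) =
      ∑ d ∈ Finset.range (n + 1), PowerSeries.coeff d f * PowerSeries.coeff n (g ^ d) := by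
  rw [PowerSeries.coeff_subst' (PowerSeries.HasSubst.of_constantCoeff_zero' hg),
    finsum_eq_sum_of_support_subset (s := Finset.range (n + 1))]
  · simp only [smul_eq_mul]
  · intro d hd
    rw [Finset.coe_range, Set.mem_Iio]
    by_contra hlt
    exact hd (by simp only [coeff_pow_eq_zero hg (show n < d by omega), smul_zero])

/-- The group operation is substitution: `(f * g)(t) = f(g(t))`. -/
instance : Mul (Nottingham p) :=
  ⟨fun f g => ⟨f.toSeries.subst g.toSeries, by
    rw [← PowerSeries.coeff_zero_eq_constantCoeff_apply,
      coeff_subst_eq_sum g.constantCoeff_toSeries]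
    simp [f.constantCoeff_toSeries], by
    rw [coeff_subst_eq_sum g.constantCoeff_toSeries]
    simp [Finset.sum_range_succ, f.constantCoeff_toSeries, f.coeff_one_toSeries,
      g.coeff_one_toSeries]⟩⟩

/-- The identity element is the series `t`. -/
instance : One (Nottingham p) := ⟨⟨PowerSeries.X, by simp, by simp⟩⟩

/-- The inverse is the compositional inverse. -/
instance : Inv (Nottingham p) :=
  ⟨fun f => ⟨f.toSeries.substInvOfIsUnit f.isUnit_coeff_one, by simp, by
    rw [PowerSeries.coeff_one_substInvOfIsUnit]
    have h : f.isUnit_coeff_one.unit = 1 := Units.ext f.coeff_one_toSeries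
    simp [h]⟩⟩

theorem toSeries_mul (f g : Nottingham p) :
    (f * g).toSeries = f.toSeries.subst g.toSeries := rfl

theorem toSeries_one : (1 : Nottingham p).toSeries = PowerSeries.X := rfl

theorem toSeries_inv (f : Nottingham p) :
    (f⁻¹).toSeries = f.toSeries.substInvOfIsUnit f.isUnit_coeff_one := rfl

instance : Group (Nottingham p) :=
  Group.ofLeftAxioms
    (fun f g h => ext_series (by
      simp only [toSeries_mul]
      exact PowerSeries.subst_comp_subst_apply g.hasSubst h.hasSubst f.toSeries))
    (fun f => ext_series (by
      rw [toSeries_mul, toSeries_one, PowerSeries.subst_X f.hasSubst]))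
    (fun f => ext_series (by
      rw [toSeries_mul, toSeries_inv, toSeries_one]
      exact PowerSeries.subst_substInvOfIsUnit_left _ f.constantCoeff_toSeries _))

/-- The topology of coefficientwise convergence, `ZMod p` being discrete. -/
instance : TopologicalSpace (Nottingham p) :=
  inferInstanceAs (TopologicalSpace {f : PowerSeries (ZMod p) //
    PowerSeries.constantCoeff f = 0 ∧ PowerSeries.coeff 1 f = 1})

theorem continuous_toSeries : Continuous (toSeries : Nottingham p → PowerSeries (ZMod p)) :=
  continuous_subtype_val

theorem continuous_coeff (n : ℕ) :
    Continuous fun f : Nottingham p => PowerSeries.coeff n f.toSeries :=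
  (PowerSeries.WithPiTopology.continuous_coeff (ZMod p) n).comp continuous_toSeries

instance : T2Space (Nottingham p) :=
  inferInstanceAs (T2Space {f : PowerSeries (ZMod p) //
    PowerSeries.constantCoeff f = 0 ∧ PowerSeries.coeff 1 f = 1})

instance [Fact p.Prime] : CompactSpace (Nottingham p) := by
  have : CompactSpace (PowerSeries (ZMod p)) :=
    inferInstanceAs (CompactSpace ((Unit →₀ ℕ) → ZMod p))
  refine isCompact_iff_compactSpace.1 (IsClosed.isCompact ?_)
  exact (isClosed_eq (PowerSeries.WithPiTopology.continuous_constantCoeff (ZMod p))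
    continuous_const).inter
    (isClosed_eq (PowerSeries.WithPiTopology.continuous_coeff (ZMod p) 1) continuous_const)

instance : ContinuousMul (Nottingham p) := by
  refine ⟨Continuous.subtype_mk (f := fun x : Nottingham p × Nottingham p =>
    x.1.toSeries.subst x.2.toSeries) ?_ _⟩
  refine continuous_pi fun e => ?_
  have h : ∀ n : ℕ, Continuous fun x : Nottingham p × Nottingham p =>
      PowerSeries.coeff n (x.1.toSeries.subst x.2.toSeries) := by
    intro n
    simp_rw [fun x : Nottingham p × Nottingham p =>
      coeff_subst_eq_sum x.2.constantCoeff_toSeries x.1.toSeries n]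
    refine continuous_finsetSum _ fun d _ => ?_
    exact ((continuous_coeff d).comp continuous_fst).mul
      ((PowerSeries.WithPiTopology.continuous_coeff (ZMod p) n).comp
        ((continuous_toSeries.comp continuous_snd).pow d))
  have he : e = Finsupp.single () (e ()) := by ext; simp
  rw [he]
  exact h (e ())

instance [Fact p.Prime] : IsTopologicalGroup (Nottingham p) where
  continuous_inv := by
    let e : Nottingham p × Nottingham p ≃ Nottingham p × Nottingham p :=
      { toFun := fun x => (x.1, x.1 * x.2)
        invFun := fun x => (x.1, x.1⁻¹ * x.2)
        left_inv := fun x => by simp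
        right_inv := fun x => by simp }
    have he : Continuous e := continuous_fst.prodMk (continuous_fst.mul continuous_snd)
    have hs : Continuous e.symm := he.continuous_symm_of_equiv_compact_to_t2
    have h : Continuous fun x : Nottingham p => (e.symm (x, 1)).2 :=
      continuous_snd.comp (hs.comp (continuous_id.prodMk continuous_const))
    simpa [e] using h

theorem coeff_pow_modEq {q m : ℕ} {g : PowerSeries (ZMod p)}
    (hg : ∀ n < m, PowerSeries.coeff n g ≠ 0 → n ≡ 1 [MOD q]) (d : ℕ) :
    ∀ n < m, PowerSeries.coeff n (g ^ d) ≠ 0 → n ≡ d [MOD q] := by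
  induction d with
  | zero =>
    intro n _ h
    rw [pow_zero, PowerSeries.coeff_one] at h
    have : n = 0 := by by_contra h0; exact h (if_neg h0)
    rw [this]
  | succ d ih =>
    intro n hn h
    rw [pow_succ, PowerSeries.coeff_mul] at h
    obtain ⟨⟨a, b⟩, hab, hne⟩ := Finset.exists_ne_zero_of_sum_ne_zero h
    rw [Finset.HasAntidiagonal.mem_antidiagonal] at hab
    dsimp only at hab hne
    have h1 := ih a (by omega) (left_ne_zero_of_mul hne)
    have h2 := hg b (by omega) (right_ne_zero_of_mul hne)
    rw [← hab]
    exact h1.add h2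

theorem modEq_one_iff {q n : ℕ} (hn : n ≠ 0) : n ≡ 1 [MOD q] ↔ ∃ k, n = q * k + 1 := by
  constructor
  · intro h
    obtain ⟨k, hk⟩ := (Nat.modEq_iff_dvd' (show 1 ≤ n by omega)).1 h.symm
    exact ⟨k, by omega⟩
  · rintro ⟨k, rfl⟩
    simp [Nat.ModEq]

end Nottingham

/-- The Fesenko group `T(r)`, `q = p ^ r`, inside the Nottingham group over `𝔽_p`: the series
`t + ∑_{k ≥ 1} a_{qk+1} t ^ (qk+1)` (the coefficient of `t` being `1` by definition of
`Nottingham p`). -/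
def fesenkoGroup (p r : ℕ) : Subgroup (Nottingham p) where
  carrier := {f | ∀ n, PowerSeries.coeff n f.toSeries ≠ 0 → ∃ k, n = p ^ r * k + 1}
  one_mem' := by
    intro n hn
    rw [Nottingham.toSeries_one, PowerSeries.coeff_X] at hn
    refine ⟨0, ?_⟩
    by_contra h
    exact hn (if_neg (by simpa using h))
  mul_mem' := by
    intro f g hf hg n hn
    rw [Nottingham.toSeries_mul,
      Nottingham.coeff_subst_eq_sum g.constantCoeff_toSeries] at hn
    obtain ⟨d, -, hne⟩ := Finset.exists_ne_zero_of_sum_ne_zero hn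
    obtain ⟨k, rfl⟩ := hf d (left_ne_zero_of_mul hne)
    have hn0 : n ≠ 0 := by
      rintro rfl
      exact right_ne_zero_of_mul hne
        (Nottingham.coeff_pow_eq_zero g.constantCoeff_toSeries (Nat.succ_pos _))
    rw [← Nottingham.modEq_one_iff hn0]
    have h1 := Nottingham.coeff_pow_modEq (q := p ^ r) (m := n + 1) (g := g.toSeries)
      (fun i _ hi => by
        obtain ⟨l, rfl⟩ := hg i hi
        simp [Nat.ModEq]) (p ^ r * k + 1) n (Nat.lt_succ_self n) (right_ne_zero_of_mul hne)
    exact h1.trans (by simp [Nat.ModEq])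
  inv_mem' := by
    intro f hf n
    have hfg : f.toSeries.subst (f⁻¹).toSeries = PowerSeries.X := by
      rw [← Nottingham.toSeries_mul, mul_inv_cancel, Nottingham.toSeries_one]
    generalize f⁻¹ = g at hfg
    induction n using Nat.strong_induction_on with
    | _ n ih =>
      intro hn
      have hn0 : n ≠ 0 := by
        rintro rfl
        exact hn (by simpa using g.constantCoeff_toSeries)
      by_contra hbad
      have hn1 : n ≠ 1 := fun h => hbad ⟨0, by simpa using h⟩
      have hlow : ∀ i < n, PowerSeries.coeff i g.toSeries ≠ 0 → i ≡ 1 [MOD p ^ r] := by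
        intro i hi hne
        obtain ⟨l, rfl⟩ := ih i hi hne
        simp [Nat.ModEq]
      have hc := congrArg (PowerSeries.coeff n) hfg
      rw [Nottingham.coeff_subst_eq_sum g.constantCoeff_toSeries, PowerSeries.coeff_X,
        if_neg hn1, Finset.sum_eq_single 1, f.coeff_one_toSeries, one_mul, pow_one] at hc
      · exact hn hc
      · intro d _ hd1
        by_contra hne
        obtain ⟨k, rfl⟩ := hf d (left_ne_zero_of_mul hne)
        have hk : p ^ r * k ≠ 0 := fun h => hd1 (by rw [h])
        have hne2 := right_ne_zero_of_mul hne
        rw [pow_succ, PowerSeries.coeff_mul] at hne2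
        obtain ⟨⟨a, b⟩, hab, hne3⟩ := Finset.exists_ne_zero_of_sum_ne_zero hne2
        rw [Finset.HasAntidiagonal.mem_antidiagonal] at hab
        dsimp only at hab hne3
        have ha : a ≠ 0 := by
          rintro rfl
          exact left_ne_zero_of_mul hne3
            (Nottingham.coeff_pow_eq_zero g.constantCoeff_toSeries (Nat.pos_of_ne_zero hk))
        have hb : b ≠ 0 := by
          rintro rfl
          exact right_ne_zero_of_mul hne3 (by simpa using g.constantCoeff_toSeries)
        have h1 := Nottingham.coeff_pow_modEq hlow _ a (by omega) (left_ne_zero_of_mul hne3)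
        have h2 := hlow b (by omega) (right_ne_zero_of_mul hne3)
        refine hbad ((Nottingham.modEq_one_iff hn0).1 ?_)
        rw [← hab]
        exact (h1.add h2).trans (by simp [Nat.ModEq])
      · intro h
        exact absurd (Finset.mem_range.2 (by omega)) h

theorem isClosed_fesenkoGroup (p r : ℕ) : IsClosed (fesenkoGroup p r : Set (Nottingham p)) := by
  have h : (fesenkoGroup p r : Set (Nottingham p)) =
      ⋂ n : {n : ℕ // ¬ ∃ k, n = p ^ r * k + 1},
        {f : Nottingham p | PowerSeries.coeff n.1 f.toSeries = 0} := by
    ext f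
    simp only [Set.mem_iInter, Set.mem_ofPred_eq, Subtype.forall]
    exact forall_congr' fun n => by
      rw [← not_imp_not, not_not]
  rw [h]
  exact isClosed_iInter fun n => isClosed_eq (Nottingham.continuous_coeff n.1) continuous_const

/-- The lower central series of a topological group, in the topological sense: every term is the
closed subgroup generated by the commutators. Term `n` is `γ_{n+1}(G)` of the usual numbering
`γ_1(G) = G`. -/
def closedLowerCentralSeries (G : Type*) [Group G] [TopologicalSpace G] [IsTopologicalGroup G] :
    ℕ → Subgroup G
  | 0 => ⊤
  | n + 1 => ⁅closedLowerCentralSeries G n, (⊤ : Subgroup G)⁆.topologicalClosure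

/-- The successive indices of a descending chain of subgroups are finite and bounded by a
constant (`relIndex` takes the value `0` exactly when the index is infinite). -/
def HasBoundedIndices {G : Type*} [Group G] (γ : ℕ → Subgroup G) : Prop :=
  ∃ C : ℕ, ∀ n : ℕ, (γ (n + 1)).relIndex (γ n) ≠ 0 ∧ (γ (n + 1)).relIndex (γ n) ≤ C

/-- Finite width of a topological group with respect to its topological lower central series. -/
def HasFiniteWidth (G : Type*) [Group G] [TopologicalSpace G] [IsTopologicalGroup G] : Prop :=
  HasBoundedIndices (closedLowerCentralSeries G)

/-- Finite width of a group with respect to its abstract lower central series. -/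
def HasFiniteAbstractWidth (G : Type*) [Group G] : Prop :=
  HasBoundedIndices (⊤ : Subgroup G).lowerCentralSeries

end

noncomputable section

open PowerSeries

/-! ### Logarithms of power series -/

namespace PowerSeries

/-! Put q = p^r and write an element of T as f = t·A(t^q). Lift A to an integral series F and let
c_n(f) be the n-th coefficient of log F, read in ℚ_p/pℤ_p. This does not depend on the lift, and A ≡
1 mod t^k exactly when c_n(f) = 0 for n < k. Since f(g) has unit series B·A(g) when g = t·B(t^q),
logarithms turn the group law into c_N(fg) = c_N(g) + c_N(f) + twist, where the twist is the sum
over w ≥ 1 of [t^w]G^(N-qw) · c_(N-qw)(f). It involves only exponents below N in the class of N mod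
q, so a commutator is governed, up to a unitriangular correction, by a difference of two twists
(`logCoeff_commutator`).

Upper bound on the terms. Give p^e ∣ n, e ≤ r, its own threshold: weight m means c_n = 0 for n <
p^e(m - eq). Dwork's congruence p·c_(pn) = c_n, together with p^(v(n)-v(w)) ∣ [t^w]G^n, shows that
each commutator raises the weight by q (`commutator_mem_weightSubgroup`). So exponents of valuation
e < r, and multiples of q for e = r, can be depths of `gamma p r n` only from p^e(1 + nq - eq) on.

Lower bound. Induction on the exponent produces, in each term, elements with prescribed leading
exponent among the non-multiples of q, by commuting approximations of (1+t^j)^(p^s) with 1+t; the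
new leading coefficient is C(p^s j, p^s) ≡ j mod p (`hasLeading`). For a multiple qu, split u = j +
a with a bounded; the commutator of approximations of 1+t^j with 1+t^a has coefficient j - a there,
and its non-multiples of q can be removed by an element of large weight (`exists_leading_multiple`).

Both bounds have the form p^e(nq + O(1)), so boundedly many depths occur in one term and not in the
next; each costs a factor of at most p in the index (`relIndex_le_of_depths`).

Abstract series. T/[T,T]-closure is finite, with representatives x_1, …, x_d. In nilpotent quotients
every element of [N,T] is a product [ν_1,x_1]⋯[ν_d,x_d] with ν_i in N. By compactness [N,T] is then
closed for closed normal N, so the two series coincide. -/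

theorem hasSubst_sub_one {R : Type*} [CommRing R] {f : R⟦X⟧} (hf : constantCoeff f = 1) :
    HasSubst (f - 1) :=
  HasSubst.of_constantCoeff_zero' (by simp [hf])

variable {K : Type*} [Field K] [Algebra ℚ K]

theorem mul_derivative_logOf {f : K⟦X⟧} (hf : constantCoeff f = 1) :
    f * d⁄dX K (logOf f) = d⁄dX K f := by
  have h1 := hasSubst_sub_one hf
  have h2 : (1 + X : K⟦X⟧) * d⁄dX K (log K) = 1 := by
    rw [deriv_log, add_mul, one_mul]
    ext n
    cases n with
    | zero => simp
    | succ n => simp [coeff_succ_X_mul, coeff_one, pow_succ]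
  have h3 := congrArg (subst (f - 1)) h2
  rw [subst_mul h1, subst_add h1, subst_X h1] at h3
  have h4 : subst (f - 1) (1 : K⟦X⟧) = 1 := by
    rw [← coe_substAlgHom h1, map_one]
  rw [h4] at h3
  rw [logOf_eq, derivative_subst h1, map_sub, derivative_one, sub_zero, ← mul_assoc]
  have h5 : (1 : K⟦X⟧) + (f - 1) = f := by ring
  rw [h5] at h3
  rw [h3, one_mul]

theorem logOf_subst {f g : K⟦X⟧} (hf : constantCoeff f = 1) (hg : constantCoeff g = 0) :
    logOf (f.subst g) = (logOf f).subst g := by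
  have hg' : HasSubst g := HasSubst.of_constantCoeff_zero' hg
  have h1 : subst g (1 : K⟦X⟧) = 1 := by rw [← coe_substAlgHom hg', map_one]
  rw [logOf_eq, logOf_eq, subst_comp_subst_apply (hasSubst_sub_one hf) hg',
    subst_sub hg', h1]

variable [CharZero K]

/-- Both sides have the same logarithmic derivative and zero constant term, and characteristic zero
makes these data decisive. -/
theorem logOf_mul {f g : K⟦X⟧} (hf : constantCoeff f = 1) (hg : constantCoeff g = 1) :
    logOf (f * g) = logOf f + logOf g := by
  have hfg : constantCoeff (f * g) = 1 := by simp [hf, hg]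
  have h0 : f * g ≠ 0 := by
    intro h
    rw [h] at hfg
    simp at hfg
  refine derivative.ext (mul_left_cancel₀ h0 ?_) ?_
  · rw [mul_derivative_logOf hfg, map_add, Derivation.leibniz, ← mul_derivative_logOf hf,
      ← mul_derivative_logOf hg]
    simp only [smul_eq_mul]
    ring
  · simp [constantCoeff_logOf, hf, hg]

theorem logOf_one : logOf (1 : K⟦X⟧) = 0 := by
  have h := logOf_mul (f := (1 : K⟦X⟧)) (g := 1) (by simp) (by simp)
  rw [mul_one] at h
  exact left_eq_add.1 h

theorem logOf_pow {f : K⟦X⟧} (hf : constantCoeff f = 1) (n : ℕ) :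
    logOf (f ^ n) = n • logOf f := by
  induction n with
  | zero => simp [logOf_one]
  | succ n ih => rw [pow_succ, logOf_mul (by simp [hf]) hf, ih, succ_nsmul]

theorem coeff_subst_eq_sum_range {R : Type*} [CommRing R] {g : R⟦X⟧} (hg : constantCoeff g = 0)
    (f : R⟦X⟧) (n : ℕ) :
    coeff n (f.subst g) = ∑ d ∈ Finset.range (n + 1), coeff d f * coeff n (g ^ d) := by
  rw [coeff_subst' (HasSubst.of_constantCoeff_zero' hg),
    finsum_eq_sum_of_support_subset (s := Finset.range (n + 1))]
  · simp only [smul_eq_mul]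
  · intro d hd
    rw [Finset.coe_range, Set.mem_Iio]
    by_contra hlt
    refine hd ?_
    have h1 : X ^ d ∣ g ^ d := pow_dvd_pow_of_dvd (X_dvd_iff.2 hg) d
    simp only [X_pow_dvd_iff.1 h1 n (by omega), smul_zero]

end PowerSeries

/-! ### The maximal ideal of the `p`-adic integers as a subgroup of the `p`-adic numbers -/

section Padic

variable (p : ℕ) [hp : Fact p.Prime]

/-- The additive group `p ℤ_p` inside `ℚ_p`. -/
def padicMaxIdeal : AddSubgroup ℚ_[p] where
  carrier := {x | ‖x‖ < 1}
  zero_mem' := by simp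
  add_mem' := fun {x y} hx hy => lt_of_le_of_lt (Padic.nonarchimedean x y) (max_lt hx hy)
  neg_mem' := fun {x} hx => by simpa using hx

variable {p}

theorem mem_padicMaxIdeal {x : ℚ_[p]} : x ∈ padicMaxIdeal p ↔ ‖x‖ < 1 := Iff.rfl

theorem padicMaxIdeal_mul_int {x : ℚ_[p]} (hx : x ∈ padicMaxIdeal p) (z : ℤ) :
    x * z ∈ padicMaxIdeal p := by
  rw [mem_padicMaxIdeal, norm_mul]
  exact lt_of_le_of_lt (mul_le_of_le_one_right (norm_nonneg _) (Padic.norm_int_le_one z)) hx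

theorem padicMaxIdeal_int {z : ℤ} : (z : ℚ_[p]) ∈ padicMaxIdeal p ↔ (p : ℤ) ∣ z :=
  Padic.norm_intCast_lt_one_iff

theorem padicMaxIdeal_nat {z : ℕ} : (z : ℚ_[p]) ∈ padicMaxIdeal p ↔ p ∣ z := by
  have := padicMaxIdeal_int (p := p) (z := z)
  rw [Int.cast_natCast, Int.natCast_dvd_natCast] at this
  exact this

/-- Since n < p^n, the valuation of n is less than n. This puts every term of log(1 + pG) into pℤ_p.
-/
theorem prime_pow_div_mem {n : ℕ} (hn : n ≠ 0) : (p : ℚ_[p]) ^ n / n ∈ padicMaxIdeal p := by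
  have hn' : (n : ℚ_[p]) ≠ 0 := by exact_mod_cast hn
  rw [mem_padicMaxIdeal, norm_div, div_lt_one (norm_pos_iff.2 hn')]
  by_contra! h
  rw [Padic.norm_p_pow] at h
  have h1 := (Padic.norm_int_le_pow_iff_dvd (p := p) (n : ℤ) n).1 (by exact_mod_cast h)
  have h2 : p ^ n ∣ n := by exact_mod_cast h1
  exact absurd (Nat.le_of_dvd (Nat.pos_of_ne_zero hn) h2)
    (not_le.2 (Nat.lt_pow_self hp.out.one_lt))

/-- The logarithm of an integral power series, as a power series over `ℚ_p`. -/
def padicLog (p : ℕ) [Fact p.Prime] (F : ℤ⟦X⟧) : ℚ_[p]⟦X⟧ :=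
  logOf (F.map (Int.castRingHom ℚ_[p]))

/-! ### Logarithms of integral series and their congruences modulo pℤ_p -/

theorem constantCoeff_map_cast {F : ℤ⟦X⟧} (hF : constantCoeff F = 1) :
    constantCoeff (F.map (Int.castRingHom ℚ_[p])) = 1 := by
  rw [← coeff_zero_eq_constantCoeff_apply, coeff_map, coeff_zero_eq_constantCoeff_apply, hF]
  simp

theorem padicLog_mul {F G : ℤ⟦X⟧} (hF : constantCoeff F = 1) (hG : constantCoeff G = 1) :
    padicLog p (F * G) = padicLog p F + padicLog p G := by
  rw [padicLog, map_mul, logOf_mul (constantCoeff_map_cast hF) (constantCoeff_map_cast hG)]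
  rfl

theorem padicLog_one : padicLog p 1 = 0 := by
  rw [padicLog, map_one, logOf_one]

theorem padicLog_pow {F : ℤ⟦X⟧} (hF : constantCoeff F = 1) (n : ℕ) :
    padicLog p (F ^ n) = n • padicLog p F := by
  rw [padicLog, map_pow, logOf_pow (constantCoeff_map_cast hF)]
  rfl

theorem padicLog_subst {F G : ℤ⟦X⟧} (hF : constantCoeff F = 1) (hG : constantCoeff G = 0) :
    padicLog p (F.subst G) = (padicLog p F).subst (G.map (Int.castRingHom ℚ_[p])) := by
  have hG' : HasSubst G := HasSubst.of_constantCoeff_zero' hG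
  have h : PowerSeries.map (Int.castRingHom ℚ_[p]) (F.subst G) =
      (F.map (Int.castRingHom ℚ_[p])).subst (G.map (Int.castRingHom ℚ_[p])) :=
    map_subst hG' F
  rw [padicLog, h, logOf_subst (constantCoeff_map_cast hF)]
  · rfl
  · rw [← coeff_zero_eq_constantCoeff_apply, coeff_map, coeff_zero_eq_constantCoeff_apply, hG]
    simp

theorem constantCoeff_padicLog {F : ℤ⟦X⟧} (hF : constantCoeff F = 1) :
    constantCoeff (padicLog p F) = 0 :=
  constantCoeff_logOf (constantCoeff_map_cast hF)

theorem coeff_padicLog_one_add_prime_mul (G : ℤ⟦X⟧) (hG : constantCoeff G = 0) (n : ℕ) :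
    coeff n (padicLog p (1 + (p : ℤ⟦X⟧) * G)) ∈ padicMaxIdeal p := by
  have h : (1 + (p : ℤ⟦X⟧) * G).map (Int.castRingHom ℚ_[p]) - 1 =
      (C (p : ℚ_[p])) * G.map (Int.castRingHom ℚ_[p]) := by
    simp
  have hG' : constantCoeff (G.map (Int.castRingHom ℚ_[p])) = 0 := by
    rw [← coeff_zero_eq_constantCoeff_apply, coeff_map, coeff_zero_eq_constantCoeff_apply, hG]
    simp
  rw [padicLog, logOf_eq, h, coeff_subst_eq_sum_range (by simp [hG'])]
  refine AddSubgroup.sum_mem _ fun d _ => ?_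
  rcases eq_or_ne d 0 with rfl | hd
  · simp
  rw [coeff_log, if_neg hd, mul_pow, ← map_pow, ← map_pow, coeff_C_mul, coeff_map]
  have h2 := padicMaxIdeal_mul_int (padicMaxIdeal_mul_int (prime_pow_div_mem (p := p) hd)
    ((-1) ^ (d + 1))) (coeff n (G ^ d))
  convert h2 using 1
  simp
  ring

theorem exists_eq_add_prime_mul {F G : ℤ⟦X⟧}
    (h : F.map (Int.castRingHom (ZMod p)) = G.map (Int.castRingHom (ZMod p))) :
    ∃ H : ℤ⟦X⟧, F = G + (p : ℤ⟦X⟧) * H := by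
  have h1 : ∀ n, ∃ z : ℤ, coeff n F - coeff n G = p * z := by
    intro n
    have h2 := congrArg (coeff n) h
    rw [coeff_map, coeff_map] at h2
    have h3 : ((coeff n F - coeff n G : ℤ) : ZMod p) = 0 := by
      push_cast
      exact sub_eq_zero.2 h2
    exact (ZMod.intCast_zmod_eq_zero_iff_dvd _ p).1 h3
  choose z hz using h1
  refine ⟨mk z, ?_⟩
  ext n
  have h4 : (p : ℤ⟦X⟧) = C (p : ℤ) := by simp
  rw [map_add, h4, coeff_C_mul, coeff_mk, ← hz]
  ring

/-- Modulo `p ℤ_p` the coefficients of the logarithm depend only on the series modulo `p`. -/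
theorem padicLog_congr {F G : ℤ⟦X⟧} (hF : constantCoeff F = 1) (hG : constantCoeff G = 1)
    (h : F.map (Int.castRingHom (ZMod p)) = G.map (Int.castRingHom (ZMod p))) (n : ℕ) :
    coeff n (padicLog p F) - coeff n (padicLog p G) ∈ padicMaxIdeal p := by
  obtain ⟨H, hH⟩ := exists_eq_add_prime_mul h
  -- Dividing by G gives F/G = 1 + p·(HU), whose logarithm is log F - log G and has coefficients in
  -- pℤ_p.
  obtain ⟨U, hU⟩ : ∃ U, G * U = 1 := ⟨_, mul_invOfUnit G 1 (by simpa using hG)⟩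
  have hU1 : constantCoeff U = 1 := by
    have := congrArg constantCoeff hU
    rwa [map_mul, hG, one_mul, map_one] at this
  have hH0 : constantCoeff H = 0 := by
    have := congrArg constantCoeff hH
    rw [map_add, hF, hG, map_mul] at this
    have h3 : (p : ℤ) * constantCoeff H = 0 := by simpa using this
    exact (mul_eq_zero.1 h3).resolve_left (by exact_mod_cast hp.out.ne_zero)
  have h1 : F * U = 1 + (p : ℤ⟦X⟧) * (H * U) := by
    rw [hH, add_mul, hU]
    ring
  have h2 := congrArg (coeff n) (padicLog_mul (p := p) hF hU1)
  have h3 := congrArg (coeff n) (padicLog_mul (p := p) hG hU1)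
  rw [hU, padicLog_one, map_add, map_zero] at h3
  rw [h1, map_add] at h2
  have h4 := coeff_padicLog_one_add_prime_mul (p := p) (H * U) (by simp [hH0]) n
  rw [h2] at h4
  have h5 : coeff n (padicLog p U) = -coeff n (padicLog p G) := by
    linear_combination -h3
  rwa [h5, ← sub_eq_add_neg] at h4

theorem zmod_expand_eq_pow (n : ℕ) (f : (ZMod p)⟦X⟧) :
    expand (p ^ n) (pow_ne_zero n hp.out.ne_zero) f = f ^ p ^ n := by
  rw [← MvPowerSeries.map_iterateFrobenius_expand p hp.out.ne_zero f n]
  have h : iterateFrobenius (ZMod p) p n = RingHom.id _ := Subsingleton.elim _ _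
  rw [h, MvPowerSeries.map_id]
  rfl

/-- Dwork's congruence. -/
theorem padicLog_dwork {F : ℤ⟦X⟧} (hF : constantCoeff F = 1) (n : ℕ) :
    (p : ℚ_[p]) * coeff (p * n) (padicLog p F) - coeff n (padicLog p F) ∈ padicMaxIdeal p := by
  have hp0 := hp.out.ne_zero
  -- F(t)^p and F(t^p) agree mod p; comparing coefficients of t^(pn) in their logarithms gives the
  -- congruence.
  have h1 : (F ^ p).map (Int.castRingHom (ZMod p)) =
      (expand p hp0 F).map (Int.castRingHom (ZMod p)) := by
    rw [map_expand, map_pow]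
    have := zmod_expand_eq_pow 1 (F.map (Int.castRingHom (ZMod p)))
    simp only [pow_one] at this
    exact this.symm
  have h2 := padicLog_congr (p := p) (by simp [hF]) (by simp [hF]) h1 (p * n)
  have hX : (X ^ p : ℤ⟦X⟧).map (Int.castRingHom ℚ_[p]) = X ^ p := by simp
  rw [padicLog_pow hF, expand_apply, padicLog_subst hF (by simp [hp0]), hX,
    ← expand_apply p hp0, coeff_expand_mul] at h2
  rwa [map_nsmul, nsmul_eq_mul] at h2

/-! ### Substituting t·G(t^q) into a logarithm -/

theorem coeff_X_mul_expand_pow {R : Type*} [CommRing R] {q : ℕ} (hq : q ≠ 0) (G : R⟦X⟧)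
    (n w : ℕ) : coeff (n + q * w) ((X * expand q hq G) ^ n) = coeff w (G ^ n) := by
  rw [mul_pow, add_comm, coeff_X_pow_mul, ← map_pow, coeff_expand_mul]

theorem coeff_X_mul_expand_pow_eq_zero {R : Type*} [CommRing R] {q : ℕ} (hq : q ≠ 0) (G : R⟦X⟧)
    {n N : ℕ} (h : ∀ w, N ≠ n + q * w) : coeff N ((X * expand q hq G) ^ n) = 0 := by
  rw [mul_pow, coeff_X_pow_mul', ← map_pow]
  split_ifs with hn
  · refine coeff_expand_of_not_dvd _ _ _ ?_
    rintro ⟨w, hw⟩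
    exact h w (by omega)
  · rfl

/-- A term t^n of log F becomes t^n·G(t^q)^n, which reaches only the exponents n + qw, with
coefficient [t^w]G^n. -/
theorem coeff_padicLog_subst {F : ℤ⟦X⟧} (hF : constantCoeff F = 1) {q : ℕ} (hq : q ≠ 0)
    (G : ℤ⟦X⟧) (N : ℕ) :
    coeff N (padicLog p (F.subst (X * expand q hq G))) =
      ∑ w ∈ Finset.range (N / q + 1),
        coeff (N - q * w) (padicLog p F) * ((coeff w (G ^ (N - q * w)) : ℤ) : ℚ_[p]) := by
  rw [padicLog_subst hF (by simp), coeff_subst_eq_sum_range (by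
    rw [← coeff_zero_eq_constantCoeff_apply, coeff_map]; simp)]
  symm
  have hle : ∀ w ∈ Finset.range (N / q + 1), q * w ≤ N := fun w hw =>
    (Nat.mul_le_mul_left q (Nat.lt_succ_iff.1 (Finset.mem_range.1 hw))).trans (Nat.mul_div_le N q)
  refine Finset.sum_of_injOn (fun w => N - q * w) ?_ ?_ ?_ ?_
  · intro a ha b hb hab
    have h1 := hle a ha
    have h2 := hle b hb
    dsimp only at hab
    exact Nat.eq_of_mul_eq_mul_left (Nat.pos_of_ne_zero hq) (by omega)
  · intro a _
    simp only [Finset.coe_range, Set.mem_Iio]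
    omega
  · intro n hn hn'
    rw [← map_pow, coeff_map, coeff_X_mul_expand_pow_eq_zero hq]
    · simp
    · rintro w rfl
      refine hn' ⟨w, ?_, by simp⟩
      simp only [Finset.coe_range, Set.mem_Iio]
      rw [Nat.lt_succ_iff, Nat.le_div_iff_mul_le (Nat.pos_of_ne_zero hq), mul_comm]
      omega
  · intro w hw
    have h := coeff_X_mul_expand_pow hq G (N - q * w) w
    rw [Nat.sub_add_cancel (hle w hw)] at h
    rw [← map_pow, coeff_map, h]
    rfl

/-- Read off from the derivative (G^n)' = n·G^(n-1)·G'. -/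
theorem mul_coeff_pow (G : ℤ⟦X⟧) (n w : ℕ) : (n : ℤ) ∣ w * coeff w (G ^ n) := by
  cases w with
  | zero => simp
  | succ w =>
    have h := congrArg (coeff w) (derivative_pow G n)
    rw [coeff_derivative] at h
    refine ⟨coeff w (G ^ (n - 1) * d⁄dX ℤ G), ?_⟩
    have h2 : (n : ℤ⟦X⟧) = C (n : ℤ) := by simp
    rw [mul_assoc, h2, coeff_C_mul] at h
    push_cast
    rw [mul_comm, h]

theorem X_pow_dvd_pow_sub_one {R : Type*} [CommRing R] {G : R⟦X⟧} {k : ℕ}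
    (h : X ^ k ∣ G - 1) (n : ℕ) : X ^ k ∣ G ^ n - 1 :=
  h.trans (by simpa using sub_dvd_pow_sub_pow G 1 n)

theorem coeff_pow_eq_zero_of_dvd {R : Type*} [CommRing R] {G : R⟦X⟧} {k : ℕ}
    (h : X ^ k ∣ G - 1) {n w : ℕ} (hw : w ≠ 0) (hk : w < k) : coeff w (G ^ n) = 0 := by
  have h1 := X_pow_dvd_iff.1 (X_pow_dvd_pow_sub_one h n) w hk
  rwa [map_sub, coeff_one, if_neg hw, sub_zero] at h1

/-- In log(1 + x) = x - x²/2 + ⋯ with x divisible by t^k, everything beyond the linear term starts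
after t^k. -/
theorem coeff_padicLog_of_dvd {F : ℤ⟦X⟧} {k : ℕ} (hk : k ≠ 0)
    (h : X ^ k ∣ F - 1) {n : ℕ} (hn : n ≤ k) :
    coeff n (padicLog p F) = if n = k then ((coeff k F : ℤ) : ℚ_[p]) else 0 := by
  have hd : X ^ k ∣ F.map (Int.castRingHom ℚ_[p]) - 1 := by
    have := map_dvd (PowerSeries.map (Int.castRingHom ℚ_[p])) h
    simpa using this
  have h0 : constantCoeff (F.map (Int.castRingHom ℚ_[p]) - 1) = 0 :=
    by
    rw [← coeff_zero_eq_constantCoeff_apply]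
    exact X_pow_dvd_iff.1 hd 0 (by omega)
  rw [padicLog, logOf_eq, coeff_subst_eq_sum_range h0]
  rw [Finset.sum_eq_single 1]
  · rw [coeff_one_log, one_mul, pow_one]
    split_ifs with hnk
    · subst hnk
      rw [map_sub, coeff_map, coeff_one, if_neg hk]
      simp
    · exact X_pow_dvd_iff.1 hd n (by omega)
  · intro d _ hd1
    rcases eq_or_ne d 0 with rfl | hd0
    · simp
    · have h2 : X ^ (k * d) ∣ (F.map (Int.castRingHom ℚ_[p]) - 1) ^ d := by
        rw [pow_mul]
        exact pow_dvd_pow_of_dvd hd d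
      rw [X_pow_dvd_iff.1 h2 n (by nlinarith [Nat.pos_of_ne_zero hk, show 2 ≤ d by omega]),
        mul_zero]
  · intro h1
    have : n = 0 := by simpa using h1
    subst this
    rw [pow_one, coeff_zero_eq_constantCoeff_apply, h0, mul_zero]

theorem coeff_padicLog_one_add_X_pow {j : ℕ} (hj : j ≠ 0) (n : ℕ) :
    coeff n (padicLog p (1 + X ^ j)) =
      if j ∣ n then coeff (n / j) (log ℚ_[p]) else 0 := by
  have h : (1 + X ^ j : ℤ⟦X⟧).map (Int.castRingHom ℚ_[p]) - 1 = X ^ j := by simp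
  rw [padicLog, logOf_eq, h, ← expand_apply j hj, coeff_expand]

end Padic

end

noncomputable section

open PowerSeries

/-! ### The logarithmic coefficients of an element of the Fesenko group -/

namespace Fesenko

variable {p r : ℕ} [hp : Fact p.Prime]

/-- The series `A` with `f(t) = t * A(t ^ (p ^ r))`. -/
def unitSeries (f : fesenkoGroup p r) : (ZMod p)⟦X⟧ :=
  mk fun k => coeff (p ^ r * k + 1) f.1.toSeries

theorem q_ne_zero (p r : ℕ) [hp : Fact p.Prime] : p ^ r ≠ 0 := pow_ne_zero r hp.out.ne_zero

theorem toSeries_eq (f : fesenkoGroup p r) :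
    f.1.toSeries = X * expand (p ^ r) (q_ne_zero p r) (unitSeries f) := by
  ext n
  cases n with
  | zero => simpa using f.1.constantCoeff_toSeries
  | succ n =>
    rw [coeff_succ_X_mul, coeff_expand]
    split_ifs with h
    · obtain ⟨k, rfl⟩ := h
      rw [Nat.mul_div_cancel_left _ (Nat.pos_of_ne_zero (q_ne_zero p r)), unitSeries, coeff_mk]
    · by_contra h0
      obtain ⟨k, hk⟩ := f.2 _ h0
      exact h ⟨k, by omega⟩

theorem constantCoeff_unitSeries (f : fesenkoGroup p r) : constantCoeff (unitSeries f) = 1 := by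
  rw [← coeff_zero_eq_constantCoeff_apply, unitSeries, coeff_mk, mul_zero, zero_add,
    f.1.coeff_one_toSeries]

theorem expand_injective {R : Type*} [CommRing R] {q : ℕ} (hq : q ≠ 0) {f g : R⟦X⟧}
    (h : expand q hq f = expand q hq g) : f = g := by
  ext n
  rw [← coeff_expand_mul q hq f n, h, coeff_expand_mul]

theorem ext_unitSeries {f g : fesenkoGroup p r} (h : unitSeries f = unitSeries g) : f = g :=
  Subtype.ext (Nottingham.ext_series (by rw [toSeries_eq, toSeries_eq, h]))

theorem unitSeries_one : unitSeries (1 : fesenkoGroup p r) = 1 := by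
  refine expand_injective (q_ne_zero p r) (X_mul_cancel ?_)
  rw [← toSeries_eq, map_one, mul_one]
  rfl

/-- Over 𝔽_p the Frobenius gives f = t·A(t)^q, hence f(g) = g·A(g)^q, and the q-th power A(g)^q is
A(g(t)) with t replaced by t^q. -/
theorem unitSeries_mul (f g : fesenkoGroup p r) :
    unitSeries (f * g) = unitSeries g * (unitSeries f).subst g.1.toSeries := by
  refine expand_injective (q_ne_zero p r) (X_mul_cancel ?_)
  have hg := g.1.hasSubst
  have h1 : (f * g).1.toSeries = (X * unitSeries f ^ p ^ r).subst g.1.toSeries := by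
    rw [← zmod_expand_eq_pow, ← toSeries_eq]
    rfl
  rw [← toSeries_eq, h1, subst_mul hg, subst_X hg, subst_pow hg, zmod_expand_eq_pow, mul_pow,
    ← mul_assoc, ← zmod_expand_eq_pow r (unitSeries g), ← toSeries_eq]

/-- The element of the Fesenko group with given unit series. -/
def ofUnitSeries (A : (ZMod p)⟦X⟧) (hA : constantCoeff A = 1) : fesenkoGroup p r :=
  ⟨⟨X * expand (p ^ r) (q_ne_zero p r) A, by simp, by
    rw [← zero_add 1, coeff_succ_X_mul]; simpa using hA⟩, by
    intro n hn
    cases n with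
    | zero => simp [Nottingham.toSeries] at hn
    | succ n =>
      change coeff (n + 1) (X * expand (p ^ r) (q_ne_zero p r) A) ≠ 0 at hn
      rw [coeff_succ_X_mul, coeff_expand] at hn
      split_ifs at hn with h
      · obtain ⟨k, rfl⟩ := h
        exact ⟨k, rfl⟩
      · exact absurd rfl hn⟩

theorem unitSeries_ofUnitSeries (A : (ZMod p)⟦X⟧) (hA : constantCoeff A = 1) :
    unitSeries (ofUnitSeries A hA : fesenkoGroup p r) = A := by
  refine expand_injective (q_ne_zero p r) (X_mul_cancel ?_)
  rw [← toSeries_eq]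
  rfl

/-- An integral lift of the unit series of `f`. -/
structure IsLift (f : fesenkoGroup p r) (F : ℤ⟦X⟧) : Prop where
  constantCoeff_eq : constantCoeff F = 1
  map_eq : F.map (Int.castRingHom (ZMod p)) = unitSeries f

/-- The integral lift with coefficients in `{0, …, p - 1}`. -/
def lift (f : fesenkoGroup p r) : ℤ⟦X⟧ := mk fun k => ((coeff k (unitSeries f)).val : ℤ)

theorem isLift_lift (f : fesenkoGroup p r) : IsLift f (lift f) where
  constantCoeff_eq := by
    have : Fact (1 < p) := ⟨hp.out.one_lt⟩
    rw [← coeff_zero_eq_constantCoeff_apply, lift, coeff_mk, coeff_zero_eq_constantCoeff_apply,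
      constantCoeff_unitSeries, ZMod.val_one]
    rfl
  map_eq := by
    ext k
    simp [lift]

theorem isLift_of_map_eq {f : fesenkoGroup p r} {A : ℤ⟦X⟧} (hA : constantCoeff A = 1)
    (h : f = ofUnitSeries (A.map (Int.castRingHom (ZMod p))) (by
      rw [← coeff_zero_eq_constantCoeff_apply, coeff_map, coeff_zero_eq_constantCoeff_apply, hA]
      simp)) : IsLift f A :=
  ⟨hA, by rw [h, unitSeries_ofUnitSeries]⟩

theorem IsLift.mul {f g : fesenkoGroup p r} {F G : ℤ⟦X⟧} (hF : IsLift f F) (hG : IsLift g G) :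
    IsLift (f * g) (G * F.subst (X * expand (p ^ r) (q_ne_zero p r) G)) where
  constantCoeff_eq := by
    rw [map_mul, hG.constantCoeff_eq, one_mul, ← coeff_zero_eq_constantCoeff_apply,
      coeff_subst_eq_sum_range (by simp)]
    simp [hF.constantCoeff_eq]
  map_eq := by
    have h0 : constantCoeff (X * expand (p ^ r) (q_ne_zero p r) G) = 0 := by simp
    have h : PowerSeries.map (Int.castRingHom (ZMod p))
        (F.subst (X * expand (p ^ r) (q_ne_zero p r) G)) =
        (F.map (Int.castRingHom (ZMod p))).subst
          ((X * expand (p ^ r) (q_ne_zero p r) G).map (Int.castRingHom (ZMod p))) :=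
      map_subst (HasSubst.of_constantCoeff_zero' h0) F
    rw [map_mul, h, hG.map_eq, hF.map_eq, map_mul, map_expand, map_X, hG.map_eq, ← toSeries_eq,
      unitSeries_mul]

/-- The group `ℚ_p / p ℤ_p` of values of the logarithmic coefficients. -/
abbrev LogValue (p : ℕ) [Fact p.Prime] : Type := ℚ_[p] ⧸ padicMaxIdeal p

/-- The `n`-th logarithmic coefficient of `f`, in `ℚ_p / p ℤ_p`. -/
def logCoeff (f : fesenkoGroup p r) (n : ℕ) : LogValue p :=
  QuotientAddGroup.mk (coeff n (padicLog p (lift f)))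

theorem logCoeff_eq {f : fesenkoGroup p r} {F : ℤ⟦X⟧} (hF : IsLift f F) (n : ℕ) :
    logCoeff f n = QuotientAddGroup.mk (coeff n (padicLog p F)) := by
  refine (QuotientAddGroup.eq_iff_sub_mem).2 ?_
  exact padicLog_congr (isLift_lift f).constantCoeff_eq hF.constantCoeff_eq
    ((isLift_lift f).map_eq.trans hF.map_eq.symm) n

theorem mk_mul_int (x : ℚ_[p]) (z : ℤ) :
    (QuotientAddGroup.mk (x * z) : LogValue p) = z • (QuotientAddGroup.mk x : LogValue p) := by
  rw [← QuotientAddGroup.mk_zsmul, zsmul_eq_mul, mul_comm]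

theorem logCoeff_zero (f : fesenkoGroup p r) : logCoeff f 0 = 0 := by
  rw [logCoeff, coeff_zero_eq_constantCoeff_apply,
    constantCoeff_padicLog (isLift_lift f).constantCoeff_eq]
  rfl

/-- The effect of the substitution `t ↦ t * G(t ^ (p ^ r))` on logarithmic coefficients, minus the
identity. -/
def twist (f : fesenkoGroup p r) (G : ℤ⟦X⟧) (N : ℕ) : LogValue p :=
  ∑ w ∈ Finset.Icc 1 (N / p ^ r), coeff w (G ^ (N - p ^ r * w)) • logCoeff f (N - p ^ r * w)

/-- The logarithm of the product G·F(tG(t^q)) is a sum; the shift w = 0 gives the coefficient of f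
itself and the shifts w ≥ 1 form the twist. -/
theorem logCoeff_mul (f : fesenkoGroup p r) {g : fesenkoGroup p r} {G : ℤ⟦X⟧} (hG : IsLift g G)
    (N : ℕ) : logCoeff (f * g) N = logCoeff g N + logCoeff f N + twist f G N := by
  have hF := isLift_lift f
  rw [logCoeff_eq (hF.mul hG), padicLog_mul hG.constantCoeff_eq, map_add,
    QuotientAddGroup.mk_add, ← logCoeff_eq hG, add_assoc,
    coeff_padicLog_subst hF.constantCoeff_eq]
  · congr 1
    rw [Finset.range_eq_Ico, Finset.sum_eq_sum_Ico_succ_bot (Nat.succ_pos _), QuotientAddGroup.mk_add]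
    congr 1
    · rw [mk_mul_int, mul_zero, Nat.sub_zero, coeff_zero_eq_constantCoeff_apply, map_pow,
        hG.constantCoeff_eq, one_pow, one_smul]
      rfl
    · rw [twist, zero_add, ← QuotientAddGroup.mk'_apply, map_sum]
      refine Finset.sum_congr (by ext; simp) fun w _ => ?_
      rw [QuotientAddGroup.mk'_apply, mk_mul_int]
      rfl
  · have := (hF.mul hG).constantCoeff_eq
    rwa [map_mul, hG.constantCoeff_eq, one_mul] at this

theorem logCoeff_one (n : ℕ) : logCoeff (1 : fesenkoGroup p r) n = 0 := by
  rw [logCoeff_eq (F := 1) ⟨by simp, by rw [map_one, unitSeries_one]⟩, padicLog_one]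
  simp

theorem prime_smul_logCoeff (f : fesenkoGroup p r) (n : ℕ) :
    (p : ℤ) • logCoeff f (p * n) = logCoeff f n := by
  rw [logCoeff, ← mk_mul_int, logCoeff]
  refine (QuotientAddGroup.eq_iff_sub_mem).2 ?_
  have := padicLog_dwork (p := p) (isLift_lift f).constantCoeff_eq n
  rwa [mul_comm] at this

theorem prime_pow_smul_logCoeff (f : fesenkoGroup p r) (b n : ℕ) :
    ((p : ℤ) ^ b) • logCoeff f (p ^ b * n) = logCoeff f n := by
  induction b with
  | zero => simp
  | succ b ih =>
    rw [pow_succ', mul_comm (p : ℤ), mul_smul, pow_succ', mul_assoc, prime_smul_logCoeff, ih]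

theorem mk_int_eq_zero {z : ℤ} :
    (QuotientAddGroup.mk (z : ℚ_[p]) : LogValue p) = 0 ↔ (p : ℤ) ∣ z := by
  rw [QuotientAddGroup.eq_zero_iff, padicMaxIdeal_int]

theorem dvd_lift {f : fesenkoGroup p r} {k : ℕ} (h : X ^ k ∣ unitSeries f - 1) :
    X ^ k ∣ lift f - 1 := by
  have : Fact (1 < p) := ⟨hp.out.one_lt⟩
  rw [X_pow_dvd_iff] at h ⊢
  intro m hm
  have h3 := h m hm
  rw [map_sub, coeff_one, sub_eq_zero] at h3 ⊢
  rw [lift, coeff_mk, h3]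
  split_ifs <;> simp [ZMod.val_one]

/-- The lowest nonzero coefficient of A - 1 is visible in the logarithm, because log(1 + x) ≡ x to
leading order. -/
theorem dvd_unitSeries_of_logCoeff {f : fesenkoGroup p r} {k : ℕ}
    (h : ∀ n < k, logCoeff f n = 0) : X ^ k ∣ unitSeries f - 1 := by
  induction k with
  | zero => simp
  | succ k ih =>
    have h1 := ih fun n hn => h n (by omega)
    rw [X_pow_dvd_iff] at h1 ⊢
    intro n hn
    rcases Nat.lt_succ_iff_lt_or_eq.1 hn with hn | rfl
    · exact h1 n hn
    rcases eq_or_ne n 0 with rfl | hn0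
    · simp [constantCoeff_unitSeries]
    have h2 : X ^ n ∣ lift f - 1 := dvd_lift (X_pow_dvd_iff.2 h1)
    have h4 := h n hn
    rw [logCoeff, coeff_padicLog_of_dvd hn0 h2 le_rfl, if_pos rfl, mk_int_eq_zero] at h4
    rw [map_sub, coeff_one, if_neg hn0, sub_zero, ← (isLift_lift f).map_eq, coeff_map]
    exact (ZMod.intCast_zmod_eq_zero_iff_dvd _ p).2 h4

end Fesenko
end

noncomputable section

open PowerSeries
open scoped commutatorElement

namespace Fesenko

variable {p r : ℕ}

/-! ### Subgroups defined by the vanishing of logarithmic coefficients -/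

/-- A set of natural numbers closed under subtracting multiples of `p ^ r`. -/
def IsStepLower (p r : ℕ) (S : Set ℕ) : Prop :=
  ∀ N ∈ S, ∀ w, p ^ r * w ≤ N → N - p ^ r * w ∈ S

theorem mem_Icc_div {N w : ℕ} (hw : w ∈ Finset.Icc 1 (N / p ^ r)) : 1 ≤ w ∧ p ^ r * w ≤ N := by
  obtain ⟨h1, h2⟩ := Finset.mem_Icc.1 hw
  exact ⟨h1, (Nat.mul_le_mul_left _ h2).trans (Nat.mul_div_le _ _)⟩

theorem IsStepLower.mem {S : Set ℕ} (hS : IsStepLower p r S) {N n w : ℕ} (hN : N ∈ S)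
    (h : N = n + p ^ r * w) : n ∈ S := by
  have := hS N hN w (by omega)
  rwa [h, Nat.add_sub_cancel] at this

theorem isStepLower_Iio (k : ℕ) : IsStepLower p r (Set.Iio k) := fun _ hN _ _ =>
  lt_of_le_of_lt (Nat.sub_le _ _) hN

/-- The exponents `n` divisible by `p ^ e` and below `p ^ e * (m - e * p ^ r)` for some
`e < R`. -/
def weightSet (p r R m : ℕ) : Set ℕ :=
  {n | ∃ e < R, p ^ e ∣ n ∧ n < p ^ e * (m - e * p ^ r)}

/-- The restriction e ≤ r enters here: then p^e divides q, so shifts by multiples of q preserve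
divisibility by p^e. -/
theorem isStepLower_weightSet {R : ℕ} (hR : R ≤ r + 1) (m : ℕ) :
    IsStepLower p r (weightSet p r R m) := by
  rintro N ⟨e, he, hd, hN⟩ w hw
  refine ⟨e, he, Nat.dvd_sub hd (Dvd.dvd.mul_right (pow_dvd_pow p (by omega)) w), by omega⟩

variable [hp : Fact p.Prime]

theorem q_pos (p r : ℕ) [hp : Fact p.Prime] : 0 < p ^ r := Nat.pos_of_ne_zero (q_ne_zero p r)

theorem twist_eq_zero {f : fesenkoGroup p r} {G : ℤ⟦X⟧} {N : ℕ}
    (h : ∀ w n, 1 ≤ w → N = n + p ^ r * w → coeff w (G ^ n) • logCoeff f n = 0) :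
    twist f G N = 0 := by
  refine Finset.sum_eq_zero fun w hw => ?_
  obtain ⟨h1, h2⟩ := mem_Icc_div hw
  exact h w _ h1 (by omega)

theorem twist_eq_zero_of_vanishing {f : fesenkoGroup p r} (G : ℤ⟦X⟧) {N : ℕ}
    (h : ∀ w n, 1 ≤ w → N = n + p ^ r * w → logCoeff f n = 0) : twist f G N = 0 :=
  twist_eq_zero fun w n h1 h2 => by rw [h w n h1 h2, smul_zero]

/-- Adding the twist is a unitriangular operation: at N it uses only smaller exponents, which again
lie in S. -/
theorem logCoeff_eq_zero_of_add_twist {S : Set ℕ} (hS : IsStepLower p r S)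
    {f : fesenkoGroup p r} {G : ℤ⟦X⟧} (h : ∀ N ∈ S, logCoeff f N + twist f G N = 0) :
    ∀ N ∈ S, logCoeff f N = 0 := by
  intro N
  induction N using Nat.strong_induction_on with
  | _ N ih =>
    intro hN
    have h1 := h N hN
    rwa [twist_eq_zero_of_vanishing, add_zero] at h1
    intro w n hw hn
    have := Nat.mul_pos (q_pos p r) hw
    exact ih n (by omega) (hS.mem hN hn)

/-- The subgroup of elements whose logarithmic coefficients vanish on `S`. -/
def vanishing (S : Set ℕ) (hS : IsStepLower p r S) : Subgroup (fesenkoGroup p r) where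
  carrier := {f | ∀ n ∈ S, logCoeff f n = 0}
  one_mem' := fun n _ => logCoeff_one n
  mul_mem' := fun {f g} hf hg N hN => by
    rw [logCoeff_mul f (isLift_lift g), hf N hN, hg N hN,
      twist_eq_zero_of_vanishing _ fun w n _ h => hf n (hS.mem hN h)]
    simp
  inv_mem' := fun {f} hf => by
    refine logCoeff_eq_zero_of_add_twist hS (G := lift f) fun N hN => ?_
    have h := logCoeff_mul f⁻¹ (isLift_lift f) N
    rw [inv_mul_cancel, logCoeff_one, hf N hN, zero_add] at h
    exact h.symm

/-- Compare the logarithms of the two sides of [b,a]·(ab) = ba; the untwisted coefficients of a and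
b cancel. -/
theorem logCoeff_commutator (b a : fesenkoGroup p r) {A B : ℤ⟦X⟧} (hA : IsLift a A)
    (hB : IsLift b B) (N : ℕ) :
    logCoeff ⁅b, a⁆ N + twist ⁅b, a⁆ (lift (a * b)) N = twist b A N - twist a B N := by
  have h1 := logCoeff_mul ⁅b, a⁆ (isLift_lift (a * b)) N
  have h2 : ⁅b, a⁆ * (a * b) = b * a := by
    rw [commutatorElement_def]
    group
  rw [h2, logCoeff_mul b hA, logCoeff_mul a hB] at h1
  have h3 : logCoeff ⁅b, a⁆ N + twist ⁅b, a⁆ (lift (a * b)) N =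
      (logCoeff b N + logCoeff a N + twist a B N + logCoeff ⁅b, a⁆ N +
        twist ⁅b, a⁆ (lift (a * b)) N) - (logCoeff b N + logCoeff a N + twist a B N) := by abel
  rw [h3, ← h1]
  abel

/-! ### The depth filtration -/

/-- The subgroup of elements `t * A(t ^ (p ^ r))` with `A ≡ 1` modulo `t ^ k`. -/
def depthSubgroup (p r : ℕ) [Fact p.Prime] (k : ℕ) : Subgroup (fesenkoGroup p r) :=
  vanishing (Set.Iio k) (isStepLower_Iio k)

theorem mem_depthSubgroup_iff_dvd {k : ℕ} {f : fesenkoGroup p r} :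
    f ∈ depthSubgroup p r k ↔ X ^ k ∣ unitSeries f - 1 := by
  refine ⟨fun h => dvd_unitSeries_of_logCoeff h, fun h n hn => ?_⟩
  rcases eq_or_ne n 0 with rfl | hn0
  · exact logCoeff_zero f
  have h1 := dvd_lift h
  have hn' : n < k := hn
  rw [logCoeff, coeff_padicLog_of_dvd (by omega) h1 hn.le, if_neg (by omega)]
  rfl

theorem depthSubgroup_antitone : Antitone (depthSubgroup p r) := fun _ _ hkl _ hf n hn =>
  hf n (lt_of_lt_of_le hn hkl)

/-- Twisting by an element of depth at least `m` shifts exponents by at least `p ^ r * m`. -/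
theorem twist_lift_eq_zero (a : fesenkoGroup p r) {b : fesenkoGroup p r} {m N : ℕ}
    (hb : b ∈ depthSubgroup p r m) (hN : N ≤ p ^ r * m) : twist a (lift b) N = 0 := by
  refine twist_eq_zero fun w n hw h => ?_
  -- The boundary case N = qm is allowed because the shift w = m lands on n = 0, where the
  -- coefficient vanishes.
  rcases eq_or_ne n 0 with rfl | hn
  · rw [logCoeff_zero, smul_zero]
  have hwm : w < m := by
    by_contra! h1
    have := Nat.mul_le_mul_left (p ^ r) h1
    omega
  rw [coeff_pow_eq_zero_of_dvd (dvd_lift (mem_depthSubgroup_iff_dvd.1 hb)) (by omega) hwm]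
  exact zero_zsmul _

theorem depthSubgroup_one : depthSubgroup p r 1 = ⊤ := by
  rw [eq_top_iff]
  intro f _ n hn
  have : n = 0 := Nat.lt_one_iff.1 hn
  rw [this, logCoeff_zero]

theorem commutator_mem_depthSubgroup {k : ℕ} {b : fesenkoGroup p r}
    (hb : b ∈ depthSubgroup p r k) (a : fesenkoGroup p r) :
    ⁅b, a⁆ ∈ depthSubgroup p r (k + 1) := by
  rcases Nat.eq_zero_or_pos k with rfl | hk
  · rw [zero_add, depthSubgroup_one]
    trivial
  refine logCoeff_eq_zero_of_add_twist (isStepLower_Iio _) (G := lift (a * b)) fun N hN => ?_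
  have hN' : N ≤ k := Nat.lt_succ_iff.1 hN
  rw [logCoeff_commutator b a (isLift_lift a) (isLift_lift b),
    twist_lift_eq_zero a hb (hN'.trans (Nat.le_mul_of_pos_left k (q_pos p r))),
    twist_eq_zero_of_vanishing, sub_zero]
  intro w n hw hn
  have := Nat.mul_pos (q_pos p r) hw
  exact hb n (show n < k by omega)

instance depthSubgroup_normal (k : ℕ) : (depthSubgroup p r k).Normal where
  conj_mem b hb a := by
    have h := commutator_mem_depthSubgroup hb a
    have h1 : a * b * a⁻¹ = (⁅b, a⁆)⁻¹ * b := by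
      rw [commutatorElement_def]
      group
    rw [h1]
    exact mul_mem (inv_mem (depthSubgroup_antitone (Nat.le_succ k) h)) hb

/-! ### The weight filtration -/

/-- The weight subgroup. -/
def weightSubgroup (p r : ℕ) [Fact p.Prime] (m : ℕ) : Subgroup (fesenkoGroup p r) :=
  vanishing (weightSet p r (r + 1) m) (isStepLower_weightSet le_rfl m)

theorem mem_weightSubgroup {m : ℕ} {f : fesenkoGroup p r} :
    f ∈ weightSubgroup p r m ↔
      ∀ e ≤ r, ∀ n, p ^ e ∣ n → n < p ^ e * (m - e * p ^ r) → logCoeff f n = 0 :=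
  ⟨fun h e he n h1 h2 => h n ⟨e, Nat.lt_succ_of_le he, h1, h2⟩,
    fun h n ⟨e, he, h1, h2⟩ => h e (Nat.le_of_lt_succ he) n h1 h2⟩

theorem weightSubgroup_le_depthSubgroup (m : ℕ) :
    weightSubgroup p r m ≤ depthSubgroup p r m := fun f hf n hn =>
  mem_weightSubgroup.1 hf 0 (Nat.zero_le _) n (by simp) (by simpa using hn)

theorem weightSubgroup_antitone : Antitone (weightSubgroup p r) := fun m m' h f hf => by
  rw [mem_weightSubgroup] at hf ⊢
  intro e he n h1 h2
  exact hf e he n h1 (lt_of_lt_of_le h2 (Nat.mul_le_mul_left _ (by omega)))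

theorem smul_eq_zero_of_dvd {z : ℤ} {b : ℕ} {x : LogValue p} (hz : (p : ℤ) ^ b ∣ z)
    (hx : ((p : ℤ) ^ b) • x = 0) : z • x = 0 := by
  obtain ⟨c, rfl⟩ := hz
  rw [mul_comm, mul_smul, hx, smul_zero]

/-- The `p`-adic valuation of the `w`-th coefficient of an `n`-th power is at least
`v(n) - v(w)`. -/
theorem prime_pow_dvd_coeff_pow (G : ℤ⟦X⟧) {n w e i : ℕ} (hw : w ≠ 0) (hn : p ^ e ∣ n)
    (hi : ¬ p ^ (i + 1) ∣ w) : (p : ℤ) ^ (e - i) ∣ coeff w (G ^ n) := by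
  rcases Nat.lt_or_ge i e with hie | hie
  · obtain ⟨v, c, hc, rfl⟩ : ∃ v c, ¬ p ∣ c ∧ w = p ^ v * c :=
      ⟨_, _, Nat.not_dvd_ordCompl hp.out hw, (Nat.ordProj_mul_ordCompl_eq_self w p).symm⟩
    have hv : v ≤ i := by
      by_contra! h
      exact hi (Dvd.dvd.mul_right (pow_dvd_pow p (by omega)) c)
    -- n divides w·[t^w]G^n; cancel the p-part of w and then its prime-to-p part.
    have h1 : ((p : ℤ) ^ e) ∣ (p ^ v * c : ℕ) * coeff (p ^ v * c) (G ^ n) := by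
      refine dvd_trans ?_ (mul_coeff_pow G n _)
      exact_mod_cast hn
    have h2 : (p : ℤ) ^ e = p ^ v * p ^ (e - v) := by
      rw [← pow_add]
      congr 1
      omega
    rw [h2, Nat.cast_mul, Nat.cast_pow, mul_assoc] at h1
    have h3 := (mul_dvd_mul_iff_left (pow_ne_zero v
      (by exact_mod_cast hp.out.ne_zero : (p : ℤ) ≠ 0))).1 h1
    have h4 : IsCoprime ((p : ℤ) ^ (e - v)) (c : ℤ) := by
      refine IsCoprime.pow_left ?_
      exact_mod_cast Nat.isCoprime_iff_coprime.2 ((Nat.Prime.coprime_iff_not_dvd hp.out).2 hc)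
    exact (pow_dvd_pow (p : ℤ) (by omega)).trans (h4.dvd_of_dvd_mul_left h3)
  · rw [Nat.sub_eq_zero_of_le hie, pow_zero]
    exact one_dvd _

/-- If n = N - qw is still beyond the level-e threshold, then w < p^e, so i = v(w) is less than e
and p^(e-i) divides [t^w]G^n. By Dwork, p^(e-i)·c_n is the coefficient at n/p^(e-i), which lies
below the level-i threshold: passing from level e to i ≤ e - 1 gains at least q, exactly the
increase in weight. -/
theorem twist_weight {m : ℕ} {b : fesenkoGroup p r} (hb : b ∈ weightSubgroup p r m) (G : ℤ⟦X⟧)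
    {e N : ℕ} (he : e ≤ r) (hd : p ^ e ∣ N) (hN : N < p ^ e * (m + p ^ r - e * p ^ r)) :
    twist b G N = 0 := by
  rw [mem_weightSubgroup] at hb
  refine twist_eq_zero fun w n hw hNn => ?_
  have hpe : p ^ e ∣ n := by
    rw [hNn] at hd
    exact (Nat.dvd_add_left (Dvd.dvd.mul_right (pow_dvd_pow p he) w)).1 hd
  by_cases hn : n < p ^ e * (m - e * p ^ r)
  · rw [hb e he n hpe hn, smul_zero]
  obtain ⟨i, c, hc, hwc⟩ : ∃ i c, ¬ p ∣ c ∧ w = p ^ i * c :=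
    ⟨_, _, Nat.not_dvd_ordCompl hp.out (by omega), (Nat.ordProj_mul_ordCompl_eq_self w p).symm⟩
  have hwi : p ^ i ≤ w := by
    rw [hwc]
    exact Nat.le_mul_of_pos_right _ (Nat.pos_of_ne_zero fun h => hc (by simp [h]))
  have hppos : ∀ s, 0 < p ^ s := fun s => pow_pos hp.out.pos s
  have hmpos : e * p ^ r < m + p ^ r := by
    by_contra! h
    rw [Nat.sub_eq_zero_of_le h, mul_zero] at hN
    omega
  have hwe : w < p ^ e := by
    have h1 : p ^ e * (m + p ^ r - e * p ^ r) ≤ p ^ e * (m - e * p ^ r) + p ^ e * p ^ r := by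
      rw [← mul_add]
      exact Nat.mul_le_mul_left _ (by omega)
    have h2 : p ^ r * w < p ^ r * p ^ e := by
      rw [mul_comm (p ^ r) (p ^ e)]
      omega
    exact lt_of_mul_lt_mul_left h2 (Nat.zero_le _)
  have hie : i < e := (Nat.pow_lt_pow_iff_right hp.out.one_lt).1 (lt_of_le_of_lt hwi hwe)
  have hlt : n < p ^ e * (m - i * p ^ r) := by
    refine lt_of_le_of_lt (by omega : n ≤ N) (lt_of_lt_of_le hN (Nat.mul_le_mul_left _ ?_))
    have : (i + 1) * p ^ r ≤ e * p ^ r := Nat.mul_le_mul_right _ hie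
    rw [add_mul, one_mul] at this
    omega
  obtain ⟨n', rfl⟩ : p ^ (e - i) ∣ n := (pow_dvd_pow p (by omega)).trans hpe
  have hsplit : p ^ e = p ^ (e - i) * p ^ i := by
    rw [← pow_add]
    congr 1
    omega
  refine smul_eq_zero_of_dvd (prime_pow_dvd_coeff_pow G (i := i) (by omega) hpe ?_) ?_
  · rw [hwc, pow_succ]
    intro h
    exact hc (Nat.dvd_of_mul_dvd_mul_left (hppos i) h)
  · rw [prime_pow_smul_logCoeff]
    refine hb i (by omega) n' ?_ ?_
    · rw [hsplit] at hpe
      exact Nat.dvd_of_mul_dvd_mul_left (hppos _) hpe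
    · rw [hsplit, mul_assoc] at hlt
      exact lt_of_mul_lt_mul_left hlt (Nat.zero_le _)

/-- Commutators raise the weight by `p ^ r`. -/
theorem commutator_mem_weightSubgroup {m : ℕ} (hm : 1 ≤ m) {b : fesenkoGroup p r}
    (hb : b ∈ weightSubgroup p r m) (a : fesenkoGroup p r) :
    ⁅b, a⁆ ∈ weightSubgroup p r (m + p ^ r) := by
  refine logCoeff_eq_zero_of_add_twist (isStepLower_weightSet le_rfl _) (G := lift (a * b)) ?_
  rintro N ⟨e, he, hd, hN⟩
  have he' : e ≤ r := Nat.le_of_lt_succ he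
  rw [logCoeff_commutator b a (isLift_lift a) (isLift_lift b), twist_weight hb _ he' hd hN,
    twist_lift_eq_zero a (weightSubgroup_le_depthSubgroup m hb), sub_zero]
  -- It remains to see N ≤ qm. For e = 0 this is m + q - 1 ≤ qm, that is (m - 1)(q - 1) ≥ 0; for e ≥
  -- 1 the threshold is at most p^e·m.
  rcases Nat.eq_zero_or_pos e with rfl | he0
  · have h1 : N < m + p ^ r := by simpa using hN
    have h2 := q_pos p r
    nlinarith
  · refine hN.le.trans (Nat.mul_le_mul (Nat.pow_le_pow_right hp.out.pos he') ?_)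
    have := Nat.le_mul_of_pos_left (p ^ r) he0
    omega

end Fesenko
end

noncomputable section

open PowerSeries
open scoped commutatorElement

namespace Fesenko

variable {p r : ℕ} [hp : Fact p.Prime]

/-! ### Basic elements -/

/-- The element with unit series `(1 + t ^ j) ^ (p ^ s)`. -/
def basicElement (p r : ℕ) [Fact p.Prime] (j s : ℕ) : fesenkoGroup p r :=
  if hj : j = 0 then 1 else
    ofUnitSeries (((1 + X ^ j) ^ p ^ s : ℤ⟦X⟧).map (Int.castRingHom (ZMod p))) (by simp [hj])

theorem isLift_basicElement {j : ℕ} (hj : j ≠ 0) (s : ℕ) :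
    IsLift (basicElement p r j s) ((1 + X ^ j) ^ p ^ s) :=
  isLift_of_map_eq (by simp [hj]) (by rw [basicElement, dif_neg hj])

theorem logCoeff_basicElement {j : ℕ} (hj : j ≠ 0) (s : ℕ) {u : ℕ} (hu : u ≠ 0) :
    logCoeff (basicElement p r j s) (j * u) =
      QuotientAddGroup.mk ((p : ℚ_[p]) ^ s * ((-1) ^ (u + 1) / u)) := by
  rw [logCoeff_eq (isLift_basicElement hj s), padicLog_pow (by simp [hj]), map_nsmul,
    coeff_padicLog_one_add_X_pow hj, if_pos (Dvd.intro _ rfl),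
    Nat.mul_div_cancel_left _ (Nat.pos_of_ne_zero hj), coeff_log, if_neg hu, nsmul_eq_mul]
  congr 1
  simp

/-- At n = ju the coefficient is ±p^s/u, which lies in pℤ_p unless p^s divides u. -/
theorem logCoeff_basicElement_eq_zero {j : ℕ} (hj : j ≠ 0) {s n : ℕ} (h : ¬ p ^ s * j ∣ n) :
    logCoeff (basicElement p r j s) n = 0 := by
  by_cases hjn : j ∣ n
  · obtain ⟨u, rfl⟩ := hjn
    have hu : u ≠ 0 := by
      rintro rfl
      exact h (by simp)
    have hu' : (u : ℚ_[p]) ≠ 0 := by exact_mod_cast hu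
    rw [logCoeff_basicElement hj s hu, QuotientAddGroup.eq_zero_iff, mem_padicMaxIdeal, norm_mul,
      norm_div, norm_pow (-1), norm_neg, norm_one, one_pow, mul_one_div,
      div_lt_one (norm_pos_iff.2 hu')]
    by_contra! h1
    rw [Padic.norm_p_pow] at h1
    have h2 := (Padic.norm_int_le_pow_iff_dvd (p := p) (u : ℤ) s).1 (by exact_mod_cast h1)
    have h3 : p ^ s ∣ u := by exact_mod_cast h2
    exact h (by rw [mul_comm]; exact mul_dvd_mul_left j h3)
  · rw [logCoeff_eq (isLift_basicElement hj s), padicLog_pow (by simp [hj]), map_nsmul,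
      coeff_padicLog_one_add_X_pow hj, if_neg hjn, smul_zero]
    rfl

theorem logCoeff_basicElement_self (hp2 : p ≠ 2) {j : ℕ} (hj : j ≠ 0) (s : ℕ) :
    logCoeff (basicElement p r j s) (p ^ s * j) = QuotientAddGroup.mk 1 := by
  have h0 : (p : ℚ_[p]) ≠ 0 := by exact_mod_cast hp.out.ne_zero
  have hodd : Even (p ^ s + 1) := ((hp.out.odd_of_ne_two hp2).pow).add_one
  rw [mul_comm, logCoeff_basicElement hj s (pow_ne_zero s hp.out.ne_zero), hodd.neg_one_pow]
  congr 1
  push_cast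
  field_simp

/-- `n` times the `n`-th logarithmic coefficient of `1 + t ^ j`. -/
theorem smul_logCoeff_basicElement_zero {j : ℕ} (hj : j ≠ 0) {u : ℕ} (hu : u ≠ 0) :
    ((j * u : ℕ) : ℤ) • logCoeff (basicElement p r j 0) (j * u) =
      QuotientAddGroup.mk ((-1) ^ (u + 1) * j : ℚ_[p]) := by
  have hu' : (u : ℚ_[p]) ≠ 0 := by exact_mod_cast hu
  rw [logCoeff_basicElement hj 0 hu, ← mk_mul_int]
  congr 1
  push_cast
  field_simp

/-- The coefficients live on multiples of p^s·j. At a level e ≥ s a nonzero such multiple is at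
least p^e·j, and j ≥ m - sq. At a level e < s it is at least p^e·(pj), and p ≥ 3 with m ≥ 2rq gives
pj ≥ 3(m - rq) ≥ m. -/
theorem basicElement_mem_weightSubgroup (hp2 : p ≠ 2) {j s m : ℕ} (hj : ¬ p ∣ j) (hs : s ≤ r)
    (hm : 2 * r * p ^ r ≤ m) (hjm : m ≤ j + s * p ^ r) :
    basicElement p r j s ∈ weightSubgroup p r m := by
  have hj0 : j ≠ 0 := by
    rintro rfl
    exact hj (dvd_zero p)
  rw [mem_weightSubgroup]
  intro e he n hpe hn
  rcases eq_or_ne n 0 with rfl | hn0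
  · exact logCoeff_zero _
  refine logCoeff_basicElement_eq_zero hj0 fun hdvd => ?_
  have hp3 : 3 ≤ p := by
    have := hp.out.two_le
    omega
  rcases le_total s e with hse | hes
  · have h1 : p ^ e * j ∣ n :=
      Nat.Coprime.mul_dvd_of_dvd_of_dvd
        (((Nat.Prime.coprime_iff_not_dvd hp.out).2 hj).pow_left e) hpe
        ((Dvd.intro_left _ rfl).trans hdvd)
    have h2 := Nat.le_of_dvd (Nat.pos_of_ne_zero hn0) h1
    have h3 : m - e * p ^ r ≤ j := by
      have := Nat.mul_le_mul_right (p ^ r) hse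
      omega
    exact absurd (Nat.mul_le_mul_left (p ^ e) h3) (by omega)
  · rcases hes.eq_or_lt with rfl | hes
    · have h2 := Nat.le_of_dvd (Nat.pos_of_ne_zero hn0) hdvd
      exact absurd (Nat.mul_le_mul_left (p ^ e) (show m - e * p ^ r ≤ j by omega)) (by omega)
    have h2 := Nat.le_of_dvd (Nat.pos_of_ne_zero hn0) hdvd
    have h4 : s * p ^ r ≤ r * p ^ r := Nat.mul_le_mul_right _ hs
    have h3 : m - e * p ^ r ≤ p * j := by
      have : m ≤ p * j := by nlinarith
      omega
    have h5 : p ^ e * (p * j) ≤ p ^ s * j := by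
      rw [← mul_assoc, ← pow_succ]
      exact Nat.mul_le_mul_right _ (Nat.pow_le_pow_right hp.out.pos hes)
    exact absurd (Nat.mul_le_mul_left (p ^ e) h3) (by omega)

/-! ### Torsion of logarithmic coefficients and cancellation -/

/-- The derivative of log F is F'/F, an integral series since F has constant term 1. -/
theorem norm_mul_coeff_padicLog_le {F : ℤ⟦X⟧} (hF : constantCoeff F = 1) (n : ℕ) :
    ‖(n : ℚ_[p]) * coeff n (padicLog p F)‖ ≤ 1 := by
  cases n with
  | zero => simp
  | succ n =>
    obtain ⟨U, hU⟩ : ∃ U, F * U = 1 := ⟨_, mul_invOfUnit F 1 (by simpa using hF)⟩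
    have h1 := mul_derivative_logOf (constantCoeff_map_cast (p := p) hF)
    have h2 : d⁄dX ℚ_[p] (padicLog p F) =
        (U * d⁄dX ℤ F).map (Int.castRingHom ℚ_[p]) := by
      have h3 : (F.map (Int.castRingHom ℚ_[p])) * (U.map (Int.castRingHom ℚ_[p])) = 1 := by
        rw [← map_mul, hU, map_one]
      have h4 : (d⁄dX ℤ F).map (Int.castRingHom ℚ_[p]) =
          d⁄dX ℚ_[p] (F.map (Int.castRingHom ℚ_[p])) := by
        ext i
        simp [coeff_derivative]
      rw [map_mul, h4, ← h1, padicLog]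
      linear_combination (-d⁄dX ℚ_[p] (logOf (F.map (Int.castRingHom ℚ_[p])))) * h3
    have h5 := congrArg (coeff n) h2
    rw [coeff_derivative, coeff_map] at h5
    push_cast
    rw [mul_comm, h5]
    exact Padic.norm_int_le_one _

theorem prime_smul_logCoeff_of_not_dvd (f : fesenkoGroup p r) {n : ℕ} (hn : ¬ p ∣ n) :
    (p : ℤ) • logCoeff f n = 0 := by
  have h1 := norm_mul_coeff_padicLog_le (p := p) (isLift_lift f).constantCoeff_eq n
  rw [norm_mul, Padic.norm_natCast_eq_one_iff.2 ((Nat.Prime.coprime_iff_not_dvd hp.out).2 hn),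
    one_mul] at h1
  rw [logCoeff, ← mk_mul_int, QuotientAddGroup.eq_zero_iff, mem_padicMaxIdeal, norm_mul,
    Int.cast_natCast]
  exact lt_of_le_of_lt (mul_le_of_le_one_left (norm_nonneg _) h1) Padic.norm_p_lt_one

theorem exists_eq_natCast_of_prime_smul {x : LogValue p} (hx : (p : ℤ) • x = 0) :
    ∃ z : ℕ, x = QuotientAddGroup.mk (z : ℚ_[p]) := by
  obtain ⟨y, rfl⟩ := QuotientAddGroup.mk_surjective x
  rw [← mk_mul_int, QuotientAddGroup.eq_zero_iff, mem_padicMaxIdeal, norm_mul, Int.cast_natCast,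
    Padic.norm_p, ← div_eq_mul_inv, div_lt_one (by exact_mod_cast hp.out.pos)] at hx
  have hy : ‖y‖ ≤ 1 := by
    have := (Padic.norm_le_pow_iff_norm_lt_pow_add_one y 0).2 (by simpa using hx)
    simpa using this
  obtain ⟨x, rfl⟩ : ∃ x : ℤ_[p], (x : ℚ_[p]) = y := ⟨⟨y, hy⟩, rfl⟩
  obtain ⟨z, -, hz⟩ := PadicInt.exists_mem_range (p := p) x
  refine ⟨z, QuotientAddGroup.eq_iff_sub_mem.2 ?_⟩
  rw [IsLocalRing.mem_maximalIdeal, PadicInt.mem_nonunits, PadicInt.norm_def, PadicInt.coe_sub,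
    PadicInt.coe_natCast] at hz
  exact hz

/-- The p-torsion of ℚ_p/pℤ_p is ℤ_p/pℤ_p, cyclic of order p, so any nonzero element generates it.
-/
theorem exists_smul_eq {x y : LogValue p} (hx : (p : ℤ) • x = 0) (hy : (p : ℤ) • y = 0)
    (hy0 : y ≠ 0) : ∃ c : ℕ, x = c • y := by
  obtain ⟨a, rfl⟩ := exists_eq_natCast_of_prime_smul hx
  obtain ⟨b, rfl⟩ := exists_eq_natCast_of_prime_smul hy
  have hb : ((b : ℕ) : ZMod p) ≠ 0 := by
    intro h
    refine hy0 ?_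
    rw [QuotientAddGroup.eq_zero_iff, padicMaxIdeal_nat]
    exact (ZMod.natCast_eq_zero_iff b p).1 h
  refine ⟨((a : ZMod p) * (b : ZMod p)⁻¹).val, ?_⟩
  rw [← QuotientAddGroup.mk_nsmul, nsmul_eq_mul, QuotientAddGroup.eq_iff_sub_mem]
  have h2 := (padicMaxIdeal_int (p := p)
    (z := (a : ℤ) - (((a : ZMod p) * (b : ZMod p)⁻¹).val : ℤ) * b)).2 ?_
  · simpa using h2
  · rw [← ZMod.intCast_zmod_eq_zero_iff_dvd]
    push_cast
    rw [ZMod.natCast_zmod_val, mul_assoc, inv_mul_cancel₀ hb, mul_one, sub_self]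

section Leading

variable {S : Set ℕ} {hS : IsStepLower p r S} {k : ℕ}

theorem logCoeff_mul_of_vanishing (hk : ∀ w n, 1 ≤ w → k = n + p ^ r * w → n ∈ S)
    {f : fesenkoGroup p r} (hf : f ∈ vanishing S hS) (g : fesenkoGroup p r) :
    logCoeff (f * g) k = logCoeff g k + logCoeff f k := by
  rw [logCoeff_mul f (isLift_lift g),
    twist_eq_zero_of_vanishing _ fun w n hw h => hf n (hk w n hw h), add_zero]

theorem logCoeff_inv_of_vanishing (hk : ∀ w n, 1 ≤ w → k = n + p ^ r * w → n ∈ S)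
    {f : fesenkoGroup p r} (hf : f ∈ vanishing S hS) : logCoeff f⁻¹ k = -logCoeff f k := by
  have h := logCoeff_mul_of_vanishing hk hf f⁻¹
  rw [mul_inv_cancel, logCoeff_one] at h
  exact eq_neg_of_add_eq_zero_left h.symm

theorem logCoeff_pow_of_vanishing (hk : ∀ w n, 1 ≤ w → k = n + p ^ r * w → n ∈ S)
    {f : fesenkoGroup p r} (hf : f ∈ vanishing S hS) (c : ℕ) :
    logCoeff (f ^ c) k = c • logCoeff f k := by
  induction c with
  | zero => simp [logCoeff_one]
  | succ c ih =>
    rw [pow_succ, logCoeff_mul_of_vanishing hk (pow_mem hf c), ih, succ_nsmul, add_comm]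

/-- Leading coefficients are p-torsion: by Dwork if p ∣ k, and by integrality of k·c_k otherwise.
This is why each depth contributes at most a factor p. -/
theorem prime_smul_logCoeff_of_vanishing (hk : ∀ n, k = p * n → n ∈ S)
    {f : fesenkoGroup p r} (hf : f ∈ vanishing S hS) : (p : ℤ) • logCoeff f k = 0 := by
  by_cases hpk : p ∣ k
  · obtain ⟨n, rfl⟩ := hpk
    rw [prime_smul_logCoeff, hf n (hk n rfl)]
  · exact prime_smul_logCoeff_of_not_dvd f hpk

/-- An element with nonzero leading coefficient at `k` can be used to cancel the leading
coefficient at `k` of any other element. -/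
theorem exists_pow_cancel (hk : ∀ w n, 1 ≤ w → k = n + p ^ r * w → n ∈ S)
    (hk' : ∀ n, k = p * n → n ∈ S) {f g : fesenkoGroup p r} (hf : f ∈ vanishing S hS)
    (hg : g ∈ vanishing S hS) (hg0 : logCoeff g k ≠ 0) :
    ∃ c : ℕ, logCoeff ((g ^ c)⁻¹ * f) k = 0 := by
  obtain ⟨c, hc⟩ := exists_smul_eq (prime_smul_logCoeff_of_vanishing hk' hf)
    (prime_smul_logCoeff_of_vanishing hk' hg) hg0
  refine ⟨c, ?_⟩
  rw [logCoeff_mul_of_vanishing hk (inv_mem (pow_mem hg c)),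
    logCoeff_inv_of_vanishing hk (pow_mem hg c), logCoeff_pow_of_vanishing hk hg, hc]
  simp

end Leading

/-! ### Topology and the lower central series -/

theorem isOpen_depthSubgroup (k : ℕ) : IsOpen (depthSubgroup p r k : Set (fesenkoGroup p r)) := by
  have h : (depthSubgroup p r k : Set (fesenkoGroup p r)) =
      ⋂ i ∈ Finset.range k,
        (fun f : fesenkoGroup p r => coeff (p ^ r * i + 1) f.1.toSeries) ⁻¹'
          {coeff i (1 : (ZMod p)⟦X⟧)} := by
    ext f
    simp only [SetLike.mem_coe, mem_depthSubgroup_iff_dvd, X_pow_dvd_iff, map_sub, sub_eq_zero,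
      Set.mem_iInter, Finset.mem_range, Set.mem_preimage, Set.mem_singleton_iff, unitSeries,
      coeff_mk]
  rw [h]
  refine isOpen_biInter_finset fun i _ => (isOpen_discrete _).preimage ?_
  exact (Nottingham.continuous_coeff _).comp continuous_subtype_val

theorem isClosed_weightSubgroup (m : ℕ) :
    IsClosed (weightSubgroup p r m : Set (fesenkoGroup p r)) := by
  -- All thresholds p^e(m - eq) are at most qm, so the subgroup contains an open depth subgroup.
  refine Subgroup.isClosed_of_isOpen _ (Subgroup.isOpen_mono (H₁ := depthSubgroup p r (p ^ r * m))
    ?_ (isOpen_depthSubgroup _))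
  intro f hf
  rw [mem_weightSubgroup]
  intro e he n _ hn
  exact hf n (lt_of_lt_of_le hn (Nat.mul_le_mul (Nat.pow_le_pow_right hp.out.pos he)
    (Nat.sub_le _ _)))

theorem weightSubgroup_one : weightSubgroup p r 1 = ⊤ := by
  rw [eq_top_iff]
  intro f _
  rw [mem_weightSubgroup]
  intro e he n hd hn
  have h1 : n < p ^ e * 1 := lt_of_lt_of_le hn (Nat.mul_le_mul_left _ (Nat.sub_le _ _))
  rw [Nat.eq_zero_of_dvd_of_lt hd (by simpa using h1), logCoeff_zero]

/-- The terms of the topological lower central series of the Fesenko group. -/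
abbrev gamma (p r : ℕ) [Fact p.Prime] (n : ℕ) : Subgroup (fesenkoGroup p r) :=
  closedLowerCentralSeries (fesenkoGroup p r) n

theorem commutator_mem_gamma {n : ℕ} {b : fesenkoGroup p r} (hb : b ∈ gamma p r n)
    (a : fesenkoGroup p r) : ⁅b, a⁆ ∈ gamma p r (n + 1) :=
  Subgroup.le_topologicalClosure _ (Subgroup.commutator_mem_commutator hb (Subgroup.mem_top a))

/-- The upper bound for the lower central series: each commutator gains weight q, starting from
weight 1, which is no condition. -/
theorem gamma_le_weightSubgroup (n : ℕ) : gamma p r n ≤ weightSubgroup p r (1 + n * p ^ r) := by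
  induction n with
  | zero =>
    rw [zero_mul, add_zero, weightSubgroup_one]
    exact le_top
  | succ n ih =>
    refine Subgroup.topologicalClosure_minimal _ ?_ (isClosed_weightSubgroup _)
    rw [Subgroup.commutator_le]
    intro b hb a _
    have := commutator_mem_weightSubgroup (by omega) (ih hb) a
    rwa [add_assoc, ← Nat.succ_mul] at this

theorem isClosed_gamma (n : ℕ) : IsClosed (gamma p r n : Set (fesenkoGroup p r)) := by
  cases n with
  | zero => exact isClosed_univ
  | succ n => exact Subgroup.isClosed_topologicalClosure _

instance gamma_normal (n : ℕ) : (gamma p r n).Normal := by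
  induction n with
  | zero => exact inferInstanceAs (⊤ : Subgroup (fesenkoGroup p r)).Normal
  | succ n ih => exact Subgroup.is_normal_topologicalClosure _

theorem gamma_succ_le (n : ℕ) : gamma p r (n + 1) ≤ gamma p r n := by
  refine Subgroup.topologicalClosure_minimal _ ?_ (isClosed_gamma n)
  exact Subgroup.commutator_le_left _ _

theorem gamma_antitone : Antitone (gamma p r) := antitone_nat_of_succ_le gamma_succ_le

end Fesenko
end

noncomputable section

open PowerSeries
open scoped commutatorElement

namespace Fesenko

/-! ### Leading terms at exponents not divisible by `p ^ r` -/

section NoPrime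

variable {p r : ℕ}

theorem isStepLower_offClass (K : ℕ) : IsStepLower p r {n | n < K ∧ ¬ p ^ r ∣ n} := by
  rintro N ⟨h1, h2⟩ w hw
  refine ⟨by omega, fun h => h2 ?_⟩
  have := dvd_add h (Dvd.intro w rfl : p ^ r ∣ p ^ r * w)
  rwa [Nat.sub_add_cancel hw] at this

/-- The reference weight of the `n`-th term of the lower central series in lower bounds. -/
def refWeight (p r n : ℕ) : ℕ := 1 + n * p ^ r + 2 * (r + 1) * p ^ r

theorem refWeight_succ (n : ℕ) : refWeight p r (n + 1) = refWeight p r n + p ^ r := by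
  rw [refWeight, refWeight]
  ring

theorem refWeight_mono : Monotone (refWeight p r) :=
  monotone_nat_of_le_succ fun n => by rw [refWeight_succ]; omega

/-- The slack of 2(r+1)q above the true weight 1 + nq makes basic elements available in these weight
subgroups and pays for the size estimates, at bounded cost. -/
theorem le_refWeight (n : ℕ) : 2 * r * p ^ r + 2 * p ^ r + 1 ≤ refWeight p r n := by
  have : refWeight p r n = 2 * r * p ^ r + 2 * p ^ r + 1 + n * p ^ r := by
    rw [refWeight]
    ring
  omega

end NoPrime

variable {p r : ℕ} [hp : Fact p.Prime]

/-- The subgroup of elements whose logarithmic coefficients vanish at the exponents below `K`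
which are not divisible by `p ^ r`. -/
def offClass (p r : ℕ) [Fact p.Prime] (K : ℕ) : Subgroup (fesenkoGroup p r) :=
  vanishing {n | n < K ∧ ¬ p ^ r ∣ n} (isStepLower_offClass K)

theorem mem_offClass {K : ℕ} {f : fesenkoGroup p r} :
    f ∈ offClass p r K ↔ ∀ n < K, ¬ p ^ r ∣ n → logCoeff f n = 0 :=
  ⟨fun h n h1 h2 => h n ⟨h1, h2⟩, fun h n hn => h n hn.1 hn.2⟩

theorem offClass_step {k n w : ℕ} (hk : ¬ p ^ r ∣ k) (hw : 1 ≤ w) (h : k = n + p ^ r * w) :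
    n < k ∧ ¬ p ^ r ∣ n := by
  have := Nat.mul_pos (q_pos p r) hw
  refine ⟨by omega, fun h1 => hk ?_⟩
  rw [h]
  exact dvd_add h1 (Dvd.intro w rfl)

theorem offClass_div {k n : ℕ} (hk : ¬ p ^ r ∣ k) (h : k = p * n) : n < k ∧ ¬ p ^ r ∣ n := by
  have h0 : n ≠ 0 := by
    rintro rfl
    exact hk (by simp [h])
  refine ⟨?_, fun h1 => hk ?_⟩
  · rw [h]
    have := hp.out.two_le
    nlinarith [Nat.pos_of_ne_zero h0]
  · rw [h]
    exact Dvd.dvd.mul_left h1 p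

/-- The `n`-th term of the lower central series has an element with leading exponent `k` among
the exponents not divisible by `p ^ r`. -/
def HasLeading (p r : ℕ) [Fact p.Prime] (n k : ℕ) : Prop :=
  ∃ C ∈ gamma p r n, C ∈ weightSubgroup p r (refWeight p r n) ∧ C ∈ offClass p r k ∧
    logCoeff C k ≠ 0

theorem HasLeading.mono {n n' k : ℕ} (h : HasLeading p r n' k) (hn : n ≤ n') :
    HasLeading p r n k := by
  obtain ⟨C, h1, h2, h3⟩ := h
  exact ⟨C, gamma_antitone hn h1, weightSubgroup_antitone (refWeight_mono hn) h2, h3⟩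

theorem exists_valuation {n : ℕ} (h : ¬ p ^ r ∣ n) :
    ∃ s < r, p ^ s ∣ n ∧ ¬ p ^ (s + 1) ∣ n := by
  have hn : n ≠ 0 := by
    rintro rfl
    exact h (dvd_zero _)
  refine ⟨n.factorization p, ?_, Nat.ordProj_dvd n p, Nat.pow_succ_factorization_not_dvd hn hp.out⟩
  by_contra! hr
  exact h ((pow_dvd_pow p hr).trans (Nat.ordProj_dvd n p))

theorem exists_refWeight_le {n₀ x : ℕ} (h0 : refWeight p r n₀ ≤ x) :
    ∃ n, n₀ ≤ n ∧ refWeight p r n ≤ x ∧ x < refWeight p r (n + 1) := by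
  have hb : ∀ n, refWeight p r n ≤ x → n ≤ x := fun n h => by
    have : n ≤ n * p ^ r := Nat.le_mul_of_pos_right n (q_pos p r)
    rw [refWeight] at h
    omega
  refine ⟨Nat.findGreatest (fun n => refWeight p r n ≤ x) x, Nat.le_findGreatest (hb _ h0) h0,
    Nat.findGreatest_spec (P := fun n => refWeight p r n ≤ x) (hb _ h0) h0, ?_⟩
  by_contra! h
  have := Nat.le_findGreatest (P := fun n => refWeight p r n ≤ x) (hb _ h) h
  omega

/-- Elements of large weight agree with elements of the lower central series up to exponents
divisible by `p ^ r`. -/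
theorem exists_approx {n K : ℕ}
    (hN : ∀ k < K, ∀ s < r, p ^ s ∣ k → ¬ p ^ (s + 1) ∣ k →
      p ^ s * (refWeight p r n - s * p ^ r) ≤ k → HasLeading p r n k)
    {D : fesenkoGroup p r} (hD : ∀ i ∈ weightSet p r r (refWeight p r n), logCoeff D i = 0) :
    ∃ B ∈ gamma p r n, B ∈ weightSubgroup p r (refWeight p r n) ∧ B⁻¹ * D ∈ offClass p r K := by
  induction K with
  | zero => exact ⟨1, one_mem _, one_mem _, fun i hi => absurd hi.1 (Nat.not_lt_zero _)⟩
  | succ K ih =>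
    obtain ⟨B, hB1, hB2, hB3⟩ := ih fun k hk => hN k (by omega)
    have key : ∀ E ∈ offClass p r K, (¬ p ^ r ∣ K → logCoeff E K = 0) → E ∈ offClass p r (K + 1) :=
      fun E hE h i hi => by
        rcases Nat.lt_succ_iff_lt_or_eq.1 hi.1 with h1 | rfl
        · exact hE i ⟨h1, hi.2⟩
        · exact h hi.2
    by_cases hqK : p ^ r ∣ K
    · exact ⟨B, hB1, hB2, key _ hB3 fun h => absurd hqK h⟩
    obtain ⟨s, hs, hs1, hs2⟩ := exists_valuation hqK
    -- Below the level-s threshold both B and D already vanish at K; above it, a power of the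
    -- available leading element cancels the coefficient.
    by_cases hlt : K < p ^ s * (refWeight p r n - s * p ^ r)
    · refine ⟨B, hB1, hB2, key _ hB3 fun _ => ?_⟩
      have hV : B⁻¹ * D ∈ vanishing (weightSet p r r (refWeight p r n))
          (isStepLower_weightSet (Nat.le_succ r) _) := by
        refine mul_mem (inv_mem ?_) hD
        rintro i ⟨e, he, h1, h2⟩
        exact hB2 i ⟨e, by omega, h1, h2⟩
      exact hV K ⟨s, hs, hs1, hlt⟩
    · obtain ⟨C, hC1, hC2, hC3, hC4⟩ := hN K (by omega) s hs hs1 hs2 (by omega)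
      obtain ⟨c, hc⟩ := exists_pow_cancel (fun w i hw h => offClass_step hqK hw h)
        (fun i h => offClass_div hqK h) hB3 hC3 hC4
      refine ⟨B * C ^ c, mul_mem hB1 (pow_mem hC1 c), mul_mem hB2 (pow_mem hC2 c), ?_⟩
      rw [mul_inv_rev, mul_assoc]
      exact key _ (mul_mem (inv_mem (pow_mem hC3 c)) hB3) fun _ => hc

theorem logCoeff_mul_of_depth (f : fesenkoGroup p r) {g : fesenkoGroup p r} {m N : ℕ}
    (hg : g ∈ depthSubgroup p r m) (hN : N ≤ p ^ r * m) :
    logCoeff (f * g) N = logCoeff g N + logCoeff f N := by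
  rw [logCoeff_mul f (isLift_lift g), twist_lift_eq_zero f hg hN, add_zero]

theorem mk_natCast_ne_zero {z : ℕ} (hz : ¬ p ∣ z) :
    (QuotientAddGroup.mk (z : ℚ_[p]) : LogValue p) ≠ 0 := by
  rwa [Ne, QuotientAddGroup.eq_zero_iff, padicMaxIdeal_nat]

theorem mk_one_ne_zero : (QuotientAddGroup.mk (1 : ℚ_[p]) : LogValue p) ≠ 0 := by
  have := mk_natCast_ne_zero (p := p) (z := 1) (fun h => hp.out.one_lt.ne'
    (Nat.dvd_one.1 h))
  simpa using this

theorem coeff_one_add_X_pow_pow (a n w : ℕ) :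
    coeff w (((1 + X ^ (a + 1) : ℤ⟦X⟧)) ^ n) =
      if a + 1 ∣ w then (n.choose (w / (a + 1)) : ℤ) else 0 := by
  have h : (1 + X ^ (a + 1) : ℤ⟦X⟧) ^ n = expand (a + 1) (Nat.succ_ne_zero a) ((1 + X) ^ n) := by
    simp
  have h2 : ((1 + X : ℤ⟦X⟧)) ^ n = ((1 + Polynomial.X : Polynomial ℤ) ^ n : Polynomial ℤ) := by
    simp
  rw [h, coeff_expand, h2]
  simp only [Polynomial.coeff_coe, Polynomial.coeff_one_add_X_pow]

/-- Lucas: each common factor p may be removed, leaving C(j, 1) = j. -/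
theorem choose_prime_pow_mul_modEq (s j : ℕ) : (p ^ s * j).choose (p ^ s) ≡ j [MOD p] := by
  induction s with
  | zero => simp [Nat.ModEq.refl]
  | succ s ih =>
    have h := Choose.choose_modEq_choose_mod_mul_choose_div_nat (p := p) (n := p ^ (s + 1) * j)
      (k := p ^ (s + 1))
    have h1 : p ^ (s + 1) * j = p * (p ^ s * j) := by ring
    have h2 : p ^ (s + 1) = p * p ^ s := by ring
    rw [h1, h2, Nat.mul_mod_right, Nat.mul_mod_right, Nat.mul_div_cancel_left _ hp.out.pos,
      Nat.mul_div_cancel_left _ hp.out.pos, Nat.choose_zero_right, one_mul] at h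
    rw [h1, h2]
    exact h.trans ih

/-- Twisting a basic element by `1 + t`: the leading term. -/
theorem twist_eq_of_eq_basicElement (hp2 : p ≠ 2) {j s k : ℕ} (hjq : p ^ r < j)
    (hk : k = p ^ s * (j + p ^ r)) {B : fesenkoGroup p r}
    (hB : ∀ n < k, ¬ p ^ r ∣ n → logCoeff B n = logCoeff (basicElement p r j s) n) :
    (∀ N < k, ¬ p ^ r ∣ N → twist B (1 + X) N = 0) ∧
      (¬ p ^ r ∣ k → twist B (1 + X) k = QuotientAddGroup.mk (j : ℚ_[p])) := by
  have hj0 : j ≠ 0 := by omega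
  have hps : 0 < p ^ s := pow_pos hp.out.pos s
  have hX : (1 + X : ℤ⟦X⟧) = (1 + X ^ (0 + 1) : ℤ⟦X⟧) := by simp
  have hcoeff : ∀ n w : ℕ, coeff w ((1 + X : ℤ⟦X⟧) ^ n) = (n.choose w : ℤ) := by
    intro n w
    rw [hX, coeff_one_add_X_pow_pow]
    simp
  -- Among non-multiples of q below k only p^s·j carries a coefficient: the next candidate 2p^s·j
  -- exceeds k because j > q.
  have hzero : ∀ n < k, ¬ p ^ r ∣ n → n ≠ p ^ s * j → logCoeff B n = 0 := by
    intro n hn hqn hne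
    rw [hB n hn hqn]
    refine logCoeff_basicElement_eq_zero hj0 ?_
    rintro ⟨u, rfl⟩
    have hu0 : u ≠ 0 := by
      rintro rfl
      exact hqn (by simp)
    have hu1 : u ≠ 1 := by
      rintro rfl
      exact hne (by simp)
    have hu : 2 ≤ u := by omega
    have h1 : p ^ s * j * 2 ≤ p ^ s * j * u := Nat.mul_le_mul_left _ hu
    have h2 : p ^ s * p ^ r < p ^ s * j := Nat.mul_lt_mul_of_pos_left hjq hps
    rw [hk, mul_add] at hn
    omega
  -- By Dwork p·c at p^s·j is c at p^(s-1)·j, which vanishes. This kills the shifts w < p^s, whose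
  -- binomial coefficients are divisible by p.
  have hpB : ¬ p ^ r ∣ p ^ s * j → 1 ≤ s → (p : ℤ) • logCoeff B (p ^ s * j) = 0 := by
    intro hq hs
    have hlt : p ^ s * j < k := by
      rw [hk, mul_add]
      have := Nat.mul_pos hps (q_pos p r)
      omega
    rw [hB _ hlt hq]
    obtain ⟨s, rfl⟩ : ∃ i, s = i + 1 := ⟨s - 1, by omega⟩
    have h1 : p ^ (s + 1) * j = p * (p ^ s * j) := by ring
    rw [h1, prime_smul_logCoeff]
    refine logCoeff_basicElement_eq_zero hj0 fun h => ?_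
    have h2 := Nat.le_of_dvd (Nat.mul_pos (pow_pos hp.out.pos s) (by omega)) h
    rw [h1] at h2
    have h3 : 0 < p ^ s * j := Nat.mul_pos (pow_pos hp.out.pos s) (by omega)
    nlinarith [hp.out.two_le]
  constructor
  · intro N hN hqN
    refine twist_eq_zero fun w n hw h => ?_
    obtain ⟨hnN, hqn⟩ := offClass_step hqN hw h
    by_cases hne : n = p ^ s * j
    · subst hne
      have hwlt : w < p ^ s := by
        have : p ^ r * w < p ^ r * p ^ s := by
          rw [hk, mul_add, mul_comm (p ^ s) (p ^ r)] at hN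
          omega
        exact lt_of_mul_lt_mul_left this (Nat.zero_le _)
      have hs : 1 ≤ s := by
        by_contra! h0
        have : s = 0 := by omega
        rw [this, pow_zero] at hwlt
        omega
      have h1 := prime_pow_dvd_coeff_pow (p := p) (1 + X : ℤ⟦X⟧) (n := p ^ s * j) (w := w) (e := s)
        (i := s - 1) (by omega) (Dvd.intro j rfl) (by
          rw [Nat.sub_add_cancel hs]
          exact Nat.not_dvd_of_pos_of_lt hw hwlt)
      rw [show s - (s - 1) = 1 by omega] at h1
      exact smul_eq_zero_of_dvd h1 (by rw [pow_one]; exact hpB hqn hs)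
    · rw [hzero n (by omega) hqn hne, smul_zero]
  · intro hqk
    -- The shift w = p^s carries p^s·j exactly to k = p^s(j + q).
    rw [twist, Finset.sum_eq_single (p ^ s)]
    · have h1 : k - p ^ r * p ^ s = p ^ s * j := by
        rw [hk, mul_add, mul_comm (p ^ s) (p ^ r), Nat.add_sub_cancel]
      have h2 := offClass_step (w := p ^ s) (n := p ^ s * j) hqk hps (by rw [hk]; ring)
      rw [h1, hcoeff, hB _ h2.1 h2.2, logCoeff_basicElement_self hp2 hj0, ← mk_mul_int, one_mul]
      refine QuotientAddGroup.eq_iff_sub_mem.2 ?_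
      have h3 := (Nat.modEq_iff_dvd.1 (choose_prime_pow_mul_modEq (p := p) s j).symm)
      have h4 := padicMaxIdeal_int.2 h3
      simpa using h4
    · intro w hw hne
      obtain ⟨h1, h2⟩ := mem_Icc_div hw
      obtain ⟨h3, h4⟩ := offClass_step (w := w) (n := k - p ^ r * w) hqk h1 (by omega)
      rw [hzero _ h3 h4, smul_zero]
      intro h5
      refine hne ?_
      have h6 : p ^ r * w = p ^ r * p ^ s := by
        rw [hk, mul_add, mul_comm (p ^ s) (p ^ r)] at h5 h2
        omega
      exact Nat.eq_of_mul_eq_mul_left (q_pos p r) h6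
    · intro h
      refine absurd (Finset.mem_Icc.2 ⟨hps, ?_⟩) h
      rw [Nat.le_div_iff_mul_le (q_pos p r), hk]
      exact Nat.mul_le_mul_left _ (by omega)

/-- Leading terms at all exponents of valuation `s < r` from a certain bound on. -/
theorem hasLeading (hp2 : p ≠ 2) (k : ℕ) :
    ∀ n s, s < r → p ^ s ∣ k → ¬ p ^ (s + 1) ∣ k →
      p ^ s * (refWeight p r n - s * p ^ r) ≤ k → HasLeading p r n k := by
  induction k using Nat.strong_induction_on with
  | _ k ih =>
  intro n₀ s hs hsk hsk' hk₀
  have hps : 0 < p ^ s := pow_pos hp.out.pos s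
  have hq := q_pos p r
  have hsq : s * p ^ r ≤ r * p ^ r := Nat.mul_le_mul_right _ hs.le
  have hqk : ¬ p ^ r ∣ k := fun h => hsk' ((pow_dvd_pow p hs).trans h)
  obtain ⟨k₀, rfl⟩ := hsk
  have hpk₀ : ¬ p ∣ k₀ := fun h => hsk' (by rw [pow_succ]; exact mul_dvd_mul_left _ h)
  -- Pass to the last term whose level-s threshold does not exceed k. This suffices since the terms
  -- decrease, and it bounds k from above as well.
  obtain ⟨n, hn₀, hn1, hn2⟩ := exists_refWeight_le (p := p) (r := r) (n₀ := n₀)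
    (x := k₀ + s * p ^ r) (by
      have := Nat.le_of_mul_le_mul_left hk₀ hps
      omega)
  refine HasLeading.mono ?_ hn₀
  cases n with
  | zero =>
    have hle := le_refWeight (p := p) (r := r) 0
    have hk0 : k₀ ≠ 0 := by
      rintro rfl
      exact hpk₀ (dvd_zero p)
    refine ⟨basicElement p r k₀ s, Subgroup.mem_top _, basicElement_mem_weightSubgroup hp2 hpk₀
      hs.le (by omega) hn1, ?_, ?_⟩
    · rw [mem_offClass]
      intro i hi hqi
      refine logCoeff_basicElement_eq_zero hk0 fun h => ?_
      have hi0 : i ≠ 0 := by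
        rintro rfl
        exact hqi (dvd_zero _)
      exact absurd (Nat.le_of_dvd (Nat.pos_of_ne_zero hi0) h) (by omega)
    · rw [logCoeff_basicElement_self hp2 hk0]
      exact mk_one_ne_zero
  | succ n =>
    have hle := le_refWeight (p := p) (r := r) n
    have hp3 : 3 ≤ p := by
      have := hp.out.two_le
      omega
    rw [refWeight_succ] at hn1 hn2
    rw [refWeight_succ] at hn2
    -- The commutator with 1 + t will shift p^s·j by q·p^s, so j is chosen with p^s(j + q) = k.
    obtain ⟨j, rfl⟩ : ∃ j, k₀ = j + p ^ r := ⟨k₀ - p ^ r, by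
      rw [mul_assoc] at hle
      omega⟩
    have hpj : ¬ p ∣ j := fun h => hpk₀ (dvd_add h (dvd_pow_self p (by omega)))
    generalize hm : refWeight p r n = m at *
    have hD0 : basicElement p r j s ∈ weightSubgroup p r m :=
      basicElement_mem_weightSubgroup hp2 hpj hs.le (by omega) (by omega)
    obtain ⟨B, hB1, hB2, hB3⟩ := exists_approx (n := n) (K := p ^ s * (j + p ^ r))
      (D := basicElement p r j s)
      (fun k' hk' s' hs' h1 h2 h3 => ih k' hk' n s' hs' h1 h2 h3) (by
        rw [hm]
        rintro i ⟨e, he, h1, h2⟩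
        exact hD0 i ⟨e, by omega, h1, h2⟩)
    rw [hm] at hB2
    have hBd := weightSubgroup_le_depthSubgroup m hB2
    have hz : B⁻¹ * basicElement p r j s ∈ depthSubgroup p r m :=
      weightSubgroup_le_depthSubgroup m (mul_mem (inv_mem hB2) hD0)
    -- Thus twisting by B, of depth at least m, is invisible up to k. Here s ≤ r - 1, and j + q < m
    -- + 2q ≤ 3m ≤ pm.
    have hkm : p ^ s * (j + p ^ r) ≤ p ^ r * m := by
      obtain ⟨t, rfl⟩ : ∃ t, r = t + 1 := ⟨r - 1, by omega⟩
      calc p ^ s * (j + p ^ (t + 1)) ≤ p ^ t * (p * m) := by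
            refine Nat.mul_le_mul (Nat.pow_le_pow_right hp.out.pos (by omega)) ?_
            nlinarith
        _ = p ^ (t + 1) * m := by ring
    have hBeq : ∀ i < p ^ s * (j + p ^ r), ¬ p ^ r ∣ i →
        logCoeff B i = logCoeff (basicElement p r j s) i := by
      intro i hi hqi
      have h1 : B = basicElement p r j s * (B⁻¹ * basicElement p r j s)⁻¹ := by group
      have h2 : (B⁻¹ * basicElement p r j s)⁻¹ ∈ offClass p r (p ^ s * (j + p ^ r)) :=
        inv_mem hB3
      conv_lhs => rw [h1]
      rw [logCoeff_mul_of_depth _ (inv_mem hz) (hi.le.trans hkm), mem_offClass.1 h2 i hi hqi,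
        zero_add]
    obtain ⟨htw1, htw2⟩ := twist_eq_of_eq_basicElement hp2 (by rw [mul_assoc] at hle; omega) rfl hBeq
    have hlift1 : IsLift (basicElement p r 1 0) (1 + X) := by
      have := isLift_basicElement (p := p) (r := r) one_ne_zero 0
      simpa using this
    have hoff : ⁅B, basicElement p r 1 0⁆ ∈ offClass p r (p ^ s * (j + p ^ r)) := by
      refine logCoeff_eq_zero_of_add_twist (isStepLower_offClass _)
        (G := lift (basicElement p r 1 0 * B)) ?_
      rintro N ⟨hN1, hN2⟩
      rw [logCoeff_commutator _ _ hlift1 (isLift_lift B), htw1 N hN1 hN2,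
        twist_lift_eq_zero _ hBd (hN1.le.trans hkm), sub_zero]
    refine ⟨⁅B, basicElement p r 1 0⁆, commutator_mem_gamma hB1 _, ?_, hoff, ?_⟩
    · rw [refWeight_succ, hm]
      exact commutator_mem_weightSubgroup (by omega) hB2 _
    · have h1 := logCoeff_commutator B _ hlift1 (isLift_lift B) (p ^ s * (j + p ^ r))
      rw [htw2 hqk, twist_lift_eq_zero _ hBd hkm, sub_zero, twist_eq_zero_of_vanishing _
        (fun w i hw h => hoff i (offClass_step hqk hw h)), add_zero] at h1
      rw [h1]
      exact mk_natCast_ne_zero hpj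

end Fesenko
end

noncomputable section

open PowerSeries
open scoped commutatorElement

namespace Fesenko

variable {p r : ℕ}

/-! ### Leading terms at exponents divisible by `p ^ r` -/

theorem isStepLower_multiples (Q : ℕ) : IsStepLower p r {n | n < Q ∧ p ^ r ∣ n} := by
  rintro N ⟨h1, h2⟩ w _
  exact ⟨by omega, Nat.dvd_sub h2 (Dvd.intro w rfl)⟩

variable [hp : Fact p.Prime]

theorem coeff_one_add_X_pow_pow_mul {a : ℕ} (ha : a ≠ 0) (n w : ℕ) :
    coeff (a * w) (((1 + X ^ a : ℤ⟦X⟧)) ^ n) = (n.choose w : ℤ) := by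
  obtain ⟨b, rfl⟩ : ∃ b, a = b + 1 := ⟨a - 1, by omega⟩
  rw [coeff_one_add_X_pow_pow, if_pos (Dvd.intro w rfl), Nat.mul_div_cancel_left _ (by omega)]

/-- To see that a twist by `1 + t ^ a` vanishes only shifts by multiples of `a` matter. -/
theorem twist_one_add_X_pow_eq_zero {f : fesenkoGroup p r} {a N : ℕ} (ha : a ≠ 0)
    (h : ∀ w n, 1 ≤ w → N = n + p ^ r * (a * w) → (n.choose w : ℤ) • logCoeff f n = 0) :
    twist f (1 + X ^ a) N = 0 := by
  refine twist_eq_zero fun w n hw hN => ?_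
  by_cases haw : a ∣ w
  · obtain ⟨w, rfl⟩ := haw
    rw [coeff_one_add_X_pow_pow_mul ha]
    refine h w n (Nat.pos_of_ne_zero ?_) hN
    rintro rfl
    simp at hw
  · obtain ⟨b, rfl⟩ : ∃ b, a = b + 1 := ⟨a - 1, by omega⟩
    rw [coeff_one_add_X_pow_pow, if_neg haw]
    exact zero_zsmul _

/-- A twist by `1 + t ^ a` to which only the shift by `a` contributes. -/
theorem twist_one_add_X_pow_eq {f : fesenkoGroup p r} {a n : ℕ} (ha : a ≠ 0)
    (h : ∀ w i, 2 ≤ w → n + p ^ r * a = i + p ^ r * (a * w) →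
      (i.choose w : ℤ) • logCoeff f i = 0) :
    twist f (1 + X ^ a) (n + p ^ r * a) = (n : ℤ) • logCoeff f n := by
  rw [twist, Finset.sum_eq_single a]
  · have h1 := coeff_one_add_X_pow_pow_mul ha n 1
    rw [mul_one, Nat.choose_one_right] at h1
    rw [Nat.add_sub_cancel, h1]
  · intro w hw hne
    obtain ⟨h1, h2⟩ := mem_Icc_div hw
    by_cases haw : a ∣ w
    · obtain ⟨w, rfl⟩ := haw
      rw [coeff_one_add_X_pow_pow_mul ha]
      refine h w _ ?_ (by omega)
      have hw0 : w ≠ 0 := by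
        rintro rfl
        simp at h1
      have hw1 : w ≠ 1 := by
        rintro rfl
        simp at hne
      omega
    · obtain ⟨b, rfl⟩ : ∃ b, a = b + 1 := ⟨a - 1, by omega⟩
      rw [coeff_one_add_X_pow_pow, if_neg haw]
      exact zero_zsmul _
  · intro h1
    refine absurd (Finset.mem_Icc.2 ⟨by omega, ?_⟩) h1
    rw [Nat.le_div_iff_mul_le (q_pos p r), mul_comm]
    omega

/-- Twisting by a product. -/
theorem twist_lift_mul (a d z : fesenkoGroup p r) {E : ℤ⟦X⟧} (hE : IsLift d E) (N : ℕ) :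
    twist a (lift (d * z)) N =
      twist a E N + twist (a * d) (lift z) N - twist d (lift z) N := by
  have h1 := logCoeff_mul a (isLift_lift (d * z)) N
  rw [← mul_assoc, logCoeff_mul (a * d) (isLift_lift z), logCoeff_mul a hE,
    logCoeff_mul d (isLift_lift z)] at h1
  have h2 : twist a (lift (d * z)) N =
      (logCoeff z N + logCoeff d N + twist d (lift z) N + logCoeff a N +
        twist a (lift (d * z)) N) -
      (logCoeff z N + logCoeff d N + twist d (lift z) N + logCoeff a N) := by abel
  rw [h2, ← h1]
  abel

theorem dvd_mul_of_basic {e j n : ℕ} (hj : ¬ p ∣ j) (he : p ^ e ∣ n) (hjn : j ∣ n) :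
    p ^ e * j ∣ n :=
  Nat.Coprime.mul_dvd_of_dvd_of_dvd
    (((Nat.Prime.coprime_iff_not_dvd hp.out).2 hj).pow_left e) he hjn

theorem smul_logCoeff_basicElement_q (hp2 : p ≠ 2) {j : ℕ} (hj : j ≠ 0) :
    ((p ^ r * j : ℕ) : ℤ) • logCoeff (basicElement p r j 0) (p ^ r * j) =
      QuotientAddGroup.mk (j : ℚ_[p]) := by
  have hodd : Even (p ^ r + 1) := ((hp.out.odd_of_ne_two hp2).pow).add_one
  have h := smul_logCoeff_basicElement_zero (p := p) (r := r) hj (q_ne_zero p r)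
  rw [hodd.neg_one_pow, one_mul, mul_comm j] at h
  exact h

/-- The twist of `1 + t ^ a` by `1 + t ^ j` at multiples of `p ^ r`. -/
theorem twist_basic_basic (hp2 : p ≠ 2) {a j : ℕ} (ha : a ≠ 0) (haj : a < j) :
    (∀ N < p ^ r * (j + a), p ^ r ∣ N → twist (basicElement p r a 0) (1 + X ^ j) N = 0) ∧
      twist (basicElement p r a 0) (1 + X ^ j) (p ^ r * (j + a)) =
        QuotientAddGroup.mk (a : ℚ_[p]) := by
  have hj : j ≠ 0 := by omega
  have hq := q_pos p r
  have hbig : ∀ w n N, N ≤ p ^ r * (j + a) → N = n + p ^ r * (j * w) → w < 2 := by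
    intro w n N hN h
    by_contra! hw
    have h1 : p ^ r * (j * 2) ≤ p ^ r * (j * w) := Nat.mul_le_mul_left _ (Nat.mul_le_mul_left _ hw)
    have h2 : p ^ r * (j + a) < p ^ r * (j * 2) := Nat.mul_lt_mul_of_pos_left (by omega) hq
    omega
  constructor
  · intro N hN hqN
    refine twist_one_add_X_pow_eq_zero hj fun w n hw h => ?_
    have hw1 : w = 1 := by
      have := hbig w n N hN.le h
      omega
    subst hw1
    rw [Nat.choose_one_right]
    rw [mul_one] at h
    by_cases han : a ∣ n
    · obtain ⟨u, rfl⟩ := han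
      rcases eq_or_ne u 0 with rfl | hu
      · simp
      rw [smul_logCoeff_basicElement_zero ha hu]
      -- At n = au the product n·c_n is ±a. It vanishes if p ∣ a; otherwise qa ∣ n, forcing N = n +
      -- qj to be at least q(j + a).
      by_cases hpa : p ∣ a
      · rw [QuotientAddGroup.eq_zero_iff]
        have := padicMaxIdeal_mul_int (padicMaxIdeal_nat.2 hpa) ((-1) ^ (u + 1))
        rw [mul_comm]
        simpa using this
      · exfalso
        have h1 : p ^ r ∣ a * u := by
          rw [h] at hqN
          exact (Nat.dvd_add_left (Dvd.intro j rfl)).1 hqN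
        have h2 := Nat.le_of_dvd (Nat.mul_pos (by omega) (by omega))
          (dvd_mul_of_basic hpa h1 (Dvd.intro u rfl))
        rw [mul_add] at hN
        omega
    · rw [logCoeff_basicElement_eq_zero ha (by simpa using han), smul_zero]
  · have h1 : p ^ r * (j + a) = p ^ r * a + p ^ r * j := by ring
    rw [h1, twist_one_add_X_pow_eq hj, smul_logCoeff_basicElement_q hp2 ha]
    intro w i hw h
    exact absurd (hbig w i _ (by rw [h1]) h) (by omega)

/-- The twist by `1 + t ^ a`, at multiples of `p ^ r`, of an element which agrees with `1 + t ^ j`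
up to an element of large depth. -/
theorem twist_eq_of_near_basic (hp2 : p ≠ 2) (hr : 1 ≤ r) {a j Y : ℕ} (ha : a ≠ 0)
    (hj : ¬ p ∣ j) {B z : fesenkoGroup p r} (hz : z ∈ depthSubgroup p r (p ^ r * Y))
    (hYj : j < Y + a) (hjY : j + a ≤ p * Y)
    (hB : ∀ n ≤ p ^ r * (j + a), logCoeff B n = logCoeff z n + logCoeff (basicElement p r j 0) n) :
    (∀ N < p ^ r * (j + a), p ^ r ∣ N → twist B (1 + X ^ a) N = 0) ∧
      twist B (1 + X ^ a) (p ^ r * (j + a)) = QuotientAddGroup.mk (j : ℚ_[p]) := by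
  have hq := q_pos p r
  have hj0 : j ≠ 0 := by
    rintro rfl
    exact hj (dvd_zero p)
  have hpq : p ∣ p ^ r := dvd_pow_self p (by omega)
  have haw : ∀ w, 1 ≤ w → a ≤ a * w := fun w hw => Nat.le_mul_of_pos_right a hw
  -- The error z never contributes. Beyond depth qY only w = 1 is possible, with factor n divisible
  -- by p, and p·c_n(z) is zero since n/p < qY.
  have hzterm : ∀ N ≤ p ^ r * (j + a), ∀ w n, 1 ≤ w → p ^ r ∣ n → N = n + p ^ r * (a * w) →
      (n.choose w : ℤ) • logCoeff z n = 0 := by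
    rintro N hN w n hw ⟨n, rfl⟩ h
    by_cases hnY : n < Y
    · rw [hz _ (Nat.mul_lt_mul_of_pos_left hnY hq), smul_zero]
    have h1 : n + a * w ≤ j + a := by
      refine le_of_mul_le_mul_left ?_ hq
      rw [mul_add]
      omega
    have hw1 : w = 1 := by
      by_contra hne
      have : a * 2 ≤ a * w := Nat.mul_le_mul_left a (by omega)
      omega
    subst hw1
    rw [Nat.choose_one_right]
    refine smul_eq_zero_of_dvd (b := 1) ?_ ?_
    · rw [pow_one]
      exact_mod_cast Dvd.dvd.mul_right hpq n
    · rw [pow_one]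
      refine prime_smul_logCoeff_of_vanishing (fun i hi => ?_) hz
      have h2 : p * i < p * (p ^ r * Y) := by
        rw [← hi, mul_left_comm]
        exact Nat.mul_lt_mul_of_pos_left (by omega) hq
      exact lt_of_mul_lt_mul_left h2 (Nat.zero_le _)
  have hbterm : ∀ N ≤ p ^ r * (j + a), ∀ w n, 1 ≤ w → p ^ r ∣ n → N = n + p ^ r * (a * w) →
      (N < p ^ r * (j + a) ∨ 2 ≤ w) →
      logCoeff (basicElement p r j 0) n = 0 := by
    intro N hN w n hw hqn h hor
    rcases eq_or_ne n 0 with rfl | hn0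
    · exact logCoeff_zero _
    refine logCoeff_basicElement_eq_zero hj0 fun hjn => ?_
    rw [pow_zero, one_mul] at hjn
    have h1 := Nat.le_of_dvd (Nat.pos_of_ne_zero hn0) (dvd_mul_of_basic hj hqn hjn)
    have h2 : p ^ r * a ≤ p ^ r * (a * w) := Nat.mul_le_mul_left _ (haw w hw)
    rw [mul_add] at hN hor
    rcases hor with h3 | h3
    · omega
    · have h4 : p ^ r * (a * 2) ≤ p ^ r * (a * w) :=
        Nat.mul_le_mul_left _ (Nat.mul_le_mul_left _ h3)
      have h5 : 0 < p ^ r * a := Nat.mul_pos hq (by omega)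
      rw [← mul_assoc, mul_two] at h4
      omega
  have hdvd : ∀ N w n, p ^ r ∣ N → N = n + p ^ r * (a * w) → p ^ r ∣ n := fun N w n h1 h2 => by
    rw [h2] at h1
    exact (Nat.dvd_add_left (Dvd.intro _ rfl)).1 h1
  constructor
  · intro N hN hqN
    refine twist_one_add_X_pow_eq_zero ha fun w n hw h => ?_
    rw [hB n (by omega), zsmul_add, hzterm N hN.le w n hw (hdvd N w n hqN h) h,
      hbterm N hN.le w n hw (hdvd N w n hqN h) h (Or.inl hN), smul_zero, add_zero]
  · have hle : p ^ r * j ≤ p ^ r * (j + a) := Nat.mul_le_mul_left _ (by omega)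
    have hz1 := hzterm _ le_rfl 1 (p ^ r * j) le_rfl (Dvd.intro j rfl) (by ring)
    rw [Nat.choose_one_right] at hz1
    rw [mul_add, twist_one_add_X_pow_eq ha, hB _ hle, zsmul_add, hz1, zero_add,
      smul_logCoeff_basicElement_q hp2 hj0]
    intro w i hw h
    rw [← mul_add] at h
    have hqi := hdvd _ w i (Dvd.intro _ rfl) h
    rw [hB i (by omega), zsmul_add, hzterm _ le_rfl w i (by omega) hqi h,
      hbterm _ le_rfl w i (by omega) hqi h (Or.inr hw), smul_zero, add_zero]

/-- Commutators with basic elements have the expected leading terms at multiples of `p ^ r`. -/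
theorem logCoeff_commutator_multiples (hp2 : p ≠ 2) (hr : 1 ≤ r) {a j Y : ℕ} (ha : a ≠ 0)
    (haj : a < j) (hj : ¬ p ∣ j) {z : fesenkoGroup p r}
    (hz : z ∈ depthSubgroup p r (p ^ r * Y)) (hYj : j < Y + a) (hjY : j + a ≤ p * Y) :
    (∀ N < p ^ r * (j + a), p ^ r ∣ N →
        logCoeff ⁅basicElement p r j 0 * z, basicElement p r a 0⁆ N = 0) ∧
      logCoeff ⁅basicElement p r j 0 * z, basicElement p r a 0⁆ (p ^ r * (j + a)) =
        QuotientAddGroup.mk ((j : ℚ_[p]) - a) := by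
  have hq := q_pos p r
  have hQ : p ^ r * (j + a) ≤ p ^ r * (p ^ r * Y) := by
    refine Nat.mul_le_mul_left _ (hjY.trans (Nat.mul_le_mul_right _ ?_))
    exact Nat.le_of_dvd hq (dvd_pow_self p (by omega))
  have hlift : ∀ i, i ≠ 0 → IsLift (basicElement p r i 0) (1 + X ^ i) := fun i hi => by
    have := isLift_basicElement (p := p) (r := r) hi 0
    simpa using this
  set B := basicElement p r j 0 * z with hBdef
  have hB : ∀ n ≤ p ^ r * (j + a), logCoeff B n =
      logCoeff z n + logCoeff (basicElement p r j 0) n := fun n hn =>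
    logCoeff_mul_of_depth _ hz (hn.trans hQ)
  -- Twisting by z is invisible up to q(j + a), so B may be replaced by 1 + t^j.
  have htw : ∀ N ≤ p ^ r * (j + a), twist (basicElement p r a 0) (lift B) N =
      twist (basicElement p r a 0) (1 + X ^ j) N := fun N hN => by
    rw [hBdef, twist_lift_mul _ _ _ (hlift j (by omega)), twist_lift_eq_zero _ hz (hN.trans hQ),
      twist_lift_eq_zero _ hz (hN.trans hQ), add_zero, sub_zero]
  obtain ⟨h1, h2⟩ := twist_eq_of_near_basic hp2 hr ha hj hz hYj hjY hB
  obtain ⟨h3, h4⟩ := twist_basic_basic (p := p) (r := r) hp2 ha haj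
  have hzero : ∀ N ∈ {n | n < p ^ r * (j + a) ∧ p ^ r ∣ n},
      logCoeff ⁅B, basicElement p r a 0⁆ N = 0 := by
    refine logCoeff_eq_zero_of_add_twist (isStepLower_multiples _)
      (G := lift (basicElement p r a 0 * B)) ?_
    rintro N ⟨hN, hqN⟩
    rw [logCoeff_commutator _ _ (hlift a ha) (isLift_lift B), h1 N hN hqN, htw N hN.le,
      h3 N hN hqN, sub_zero]
  refine ⟨fun N hN hqN => hzero N ⟨hN, hqN⟩, ?_⟩
  have h5 := logCoeff_commutator B _ (hlift a ha) (isLift_lift B) (p ^ r * (j + a))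
  rw [h2, htw _ le_rfl, h4, twist_eq_zero_of_vanishing, add_zero] at h5
  · rw [h5]
    rfl
  · intro w n hw h
    have h6 := Nat.mul_pos hq hw
    refine hzero n ⟨by omega, ?_⟩
    have h7 : p ^ r ∣ n + p ^ r * w := by
      rw [← h]
      exact Dvd.intro _ rfl
    exact (Nat.dvd_add_left (Dvd.intro _ rfl)).1 h7

end Fesenko
end

noncomputable section

open PowerSeries
open scoped commutatorElement

namespace Fesenko

variable {p r : ℕ} [hp : Fact p.Prime]

/-! ### Elements of depth qu in the lower central series -/

/-- If p ∤ u take a = (r+2)q ≡ 0, so j - a ≡ u; if p ∣ u take a = (r+2)q + 1, so j ≡ -1 and j - a ≡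
-2, nonzero as p is odd. The size (r+2)q makes the commutator with 1 + t^a vanish far enough off the
multiples of q. -/
theorem exists_splitting (hp2 : p ≠ 2) (hr : 1 ≤ r) {u : ℕ} (hu : (r + 2) * p ^ r + 1 ≤ u) :
    ∃ a j, u = j + a ∧ (r + 2) * p ^ r ≤ a ∧ a ≤ (r + 2) * p ^ r + 1 ∧ ¬ p ∣ j ∧
      (QuotientAddGroup.mk ((j : ℚ_[p]) - a) : LogValue p) ≠ 0 := by
  have hdvd : p ∣ (r + 2) * p ^ r := Dvd.dvd.mul_left (dvd_pow_self p (by omega)) _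
  have hne : ∀ j a : ℕ, ¬ (p : ℤ) ∣ (j : ℤ) - a →
      (QuotientAddGroup.mk ((j : ℚ_[p]) - a) : LogValue p) ≠ 0 := by
    intro j a h h0
    have h1 : (QuotientAddGroup.mk (((j : ℤ) - a : ℤ) : ℚ_[p]) : LogValue p) = 0 := by
      rw [← h0]
      push_cast
      rfl
    exact h (mk_int_eq_zero.1 h1)
  have hdz : (p : ℤ) ∣ (((r + 2) * p ^ r : ℕ) : ℤ) := by exact_mod_cast hdvd
  generalize (r + 2) * p ^ r = a at *
  by_cases hpu : p ∣ u
  · have hpuz : (p : ℤ) ∣ (u : ℤ) := by exact_mod_cast hpu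
    refine ⟨a + 1, u - (a + 1), by omega, by omega, le_rfl, fun h => ?_, hne _ _ fun h => ?_⟩
    · have h1 : u = u - (a + 1) + a + 1 := by omega
      have h2 : p ∣ u - (a + 1) + a := dvd_add h hdvd
      rw [h1] at hpu
      exact hp.out.one_lt.ne' (Nat.dvd_one.1 ((Nat.dvd_add_right h2).1 hpu))
    · have h1 : (2 : ℤ) = u - 2 * a - (((u - (a + 1) : ℕ) : ℤ) - ((a + 1 : ℕ) : ℤ)) := by
        omega
      have h2 : (p : ℤ) ∣ 2 := by
        rw [h1]
        exact dvd_sub (dvd_sub hpuz (Dvd.dvd.mul_left hdz 2)) h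
      have h3 : p ∣ 2 := by exact_mod_cast h2
      exact hp2 ((Nat.prime_dvd_prime_iff_eq hp.out Nat.prime_two).1 h3)
  · refine ⟨a, u - a, by omega, le_rfl, by omega, fun h => hpu ?_, hne _ _ fun h => hpu ?_⟩
    · have := dvd_add h hdvd
      rwa [Nat.sub_add_cancel (by omega)] at this
    · have h1 : (u : ℤ) = ((u - a : ℕ) : ℤ) - a + a + a := by omega
      have h2 : (p : ℤ) ∣ u := by
        rw [h1]
        exact dvd_add (dvd_add h hdz) hdz
      exact_mod_cast h2

/-- The nonmultiples of `p ^ r` in the logarithm of a commutator with `1 + t ^ a`. -/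
theorem commutator_vanishing_weightSet {a j m M : ℕ} (hj : ¬ p ∣ j)
    (hM1 : M ≤ j + p * a) (hM2 : M ≤ p * m) (hjY : j ≤ p * (m - r * p ^ r)) (ha : a ≠ 0)
    {B z : fesenkoGroup p r} (hB : B = basicElement p r j 0 * z)
    (hBm : B ∈ depthSubgroup p r m) (hzm : z ∈ weightSubgroup p r m)
    (hz : z ∈ offClass p r (p ^ r * m)) :
    ∀ N ∈ weightSet p r r M, logCoeff ⁅B, basicElement p r a 0⁆ N = 0 := by
  have hj0 : j ≠ 0 := by
    rintro rfl
    exact hj (dvd_zero p)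
  have hlift : IsLift (basicElement p r a 0) (1 + X ^ a) := by
    have := isLift_basicElement (p := p) (r := r) ha 0
    simpa using this
  refine logCoeff_eq_zero_of_add_twist (isStepLower_weightSet (Nat.le_succ r) M)
    (G := lift (basicElement p r a 0 * B)) ?_
  rintro N ⟨e, he, hpe, hN⟩
  have hq : p ^ r = p ^ e * (p * p ^ (r - e - 1)) := by
    rw [← pow_succ', ← pow_add]
    congr 1
    omega
  have hqle : ∀ x, p ^ e * (p * x) ≤ p ^ r * x := fun x => by
    rw [hq, mul_assoc, mul_assoc]
    refine Nat.mul_le_mul_left _ (Nat.mul_le_mul_left _ ?_)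
    exact Nat.le_mul_of_pos_left x (pow_pos hp.out.pos _)
  have hNM : N < p ^ e * M := lt_of_lt_of_le hN (Nat.mul_le_mul_left _ (Nat.sub_le _ _))
  have hNm : N < p ^ r * m :=
    lt_of_lt_of_le hNM ((Nat.mul_le_mul_left _ hM2).trans (hqle m))
  rw [logCoeff_commutator _ _ hlift (isLift_lift B), twist_lift_eq_zero _ hBm hNm.le, sub_zero]
  refine twist_one_add_X_pow_eq_zero ha fun w n hw h => ?_
  -- For e < r every shift is at least q·a ≥ p^e·(pa). This gain is why the bound M ≤ j + pa
  -- suffices.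
  have haw : p ^ e * (p * a) ≤ p ^ r * (a * w) :=
    (hqle a).trans (Nat.mul_le_mul_left _ (Nat.le_mul_of_pos_right a hw))
  have hpn : p ^ e ∣ n := by
    rw [h] at hpe
    exact (Nat.dvd_add_left (Dvd.dvd.mul_right (pow_dvd_pow p he.le) _)).1 hpe
  rcases eq_or_ne n 0 with rfl | hn0
  · rw [logCoeff_zero, smul_zero]
  have h1 : logCoeff (basicElement p r j 0) n = 0 := by
    refine logCoeff_basicElement_eq_zero hj0 fun hjn => ?_
    rw [pow_zero, one_mul] at hjn
    have h2 := Nat.le_of_dvd (Nat.pos_of_ne_zero hn0) (dvd_mul_of_basic hj hpn hjn)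
    have h3 : p ^ e * M ≤ p ^ e * j + p ^ e * (p * a) := by
      rw [← mul_add]
      exact Nat.mul_le_mul_left _ hM1
    omega
  have h2 : logCoeff z n = 0 := by
    by_cases hqn : p ^ r ∣ n
    · by_cases hnY : n < p ^ r * (m - r * p ^ r)
      · exact mem_weightSubgroup.1 hzm r le_rfl n hqn hnY
      · exfalso
        have h3 : p ^ e * j ≤ p ^ r * (m - r * p ^ r) :=
          (Nat.mul_le_mul_left _ hjY).trans (hqle _)
        have h4 : p ^ e * M ≤ p ^ e * j + p ^ e * (p * a) := by
          rw [← mul_add]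
          exact Nat.mul_le_mul_left _ hM1
        omega
    · exact mem_offClass.1 hz n (by omega) hqn
  rw [hB, logCoeff_mul_of_depth _ (weightSubgroup_le_depthSubgroup m hzm) (by omega), h1, h2,
    add_zero, smul_zero]

/-- Approximate 1 + t^j by B in the n-th term and commute with 1 + t^a: the leading coefficient
among multiples of q is j - a at qu. The remaining lower terms are non-multiples of q, removed by an
E of weight M so large that E does not touch multiples of q up to qu. -/
theorem exists_leading_multiple_of_le (hp2 : p ≠ 2) (hr : 1 ≤ r) {n u : ℕ}
    (hu1 : refWeight p r n + (r + 2) * p ^ r + 1 ≤ u)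
    (hu2 : u ≤ refWeight p r n + (r + 3) * p ^ r) :
    ∃ C ∈ gamma p r (n + 1), C ∈ depthSubgroup p r (p ^ r * u) ∧ logCoeff C (p ^ r * u) ≠ 0 := by
  have hp3 : 3 ≤ p := by
    have := hp.out.two_le
    omega
  have hq := q_pos p r
  obtain ⟨a, j, rfl, ha1, ha2, hj, hja⟩ := exists_splitting (p := p) (r := r) hp2 hr (u := u)
    (by omega)
  have hle := le_refWeight (p := p) (r := r) n
  have hrq : p ^ r ≤ r * p ^ r := Nat.le_mul_of_pos_left _ hr
  -- M, the next reference weight, satisfies u + rq < M ≤ u + (r+1)q: the first inequality makes E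
  -- vanish at multiples of q up to qu, the second gives M ≤ j + pa.
  obtain ⟨n', hn', hn1, hn2⟩ := exists_refWeight_le (p := p) (r := r) (n₀ := n)
    (x := j + a + r * p ^ r) (by omega)
  have hM := refWeight_succ (p := p) (r := r) n'
  generalize hM' : refWeight p r (n' + 1) = M at *
  have hD0 : basicElement p r j 0 ∈ weightSubgroup p r (refWeight p r n) :=
    basicElement_mem_weightSubgroup hp2 hj (Nat.zero_le _) (by omega) (by
      rw [add_mul] at *
      omega)
  obtain ⟨B, hB1, hB2, hB3⟩ := exists_approx (n := n) (K := p ^ r * (j + a) + 1)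
    (D := basicElement p r j 0) (fun k _ s => hasLeading hp2 k n s) (by
      rintro i ⟨e, he, h1, h2⟩
      exact hD0 i ⟨e, by omega, h1, h2⟩)
  generalize hm : refWeight p r n = m at *
  have e1 : (r + 2) * p ^ r = r * p ^ r + 2 * p ^ r := by ring
  have e2 : (r + 3) * p ^ r = r * p ^ r + 3 * p ^ r := by ring
  have e3 : 2 * r * p ^ r = 2 * (r * p ^ r) := by ring
  rw [e1] at hu1 ha1 ha2
  rw [e2] at hu2
  rw [e3] at hle
  generalize hR : r * p ^ r = R at *
  obtain ⟨z, hz⟩ : ∃ z, z = (B⁻¹ * basicElement p r j 0)⁻¹ := ⟨_, rfl⟩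
  have hBz : B = basicElement p r j 0 * z := by
    rw [hz]
    group
  have hzw : z ∈ weightSubgroup p r m := by
    rw [hz]
    exact inv_mem (mul_mem (inv_mem hB2) hD0)
  have hzo : z ∈ offClass p r (p ^ r * (j + a) + 1) := by
    rw [hz]
    exact inv_mem hB3
  have hpY : 3 * (m - R) ≤ p * (m - R) := Nat.mul_le_mul_right _ hp3
  have hpm : 3 * m ≤ p * m := Nat.mul_le_mul_right _ hp3
  have hpa : 3 * a ≤ p * a := Nat.mul_le_mul_right _ hp3
  have hzd : z ∈ depthSubgroup p r (p ^ r * (m - R)) := by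
    intro i hi
    have hi' : i < p ^ r * (m - R) := hi
    by_cases hqi : p ^ r ∣ i
    · exact mem_weightSubgroup.1 hzw r le_rfl i hqi (by rw [hR]; exact hi')
    · refine mem_offClass.1 hzo i ?_ hqi
      have : p ^ r * (m - R) ≤ p ^ r * (j + a) := Nat.mul_le_mul_left _ (by omega)
      omega
  have hoff : z ∈ offClass p r (p ^ r * m) := by
    rw [mem_offClass] at hzo ⊢
    intro i hi hqi
    refine hzo i ?_ hqi
    have : p ^ r * m ≤ p ^ r * (j + a) := Nat.mul_le_mul_left _ (by omega)
    omega
  obtain ⟨hc1, hc2⟩ := logCoeff_commutator_multiples (a := a) hp2 hr (by omega) (by omega) hj hzd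
    (by omega) (by omega)
  have hw := commutator_vanishing_weightSet (p := p) (r := r) (a := a) (m := m) (M := M) hj
    (by omega) (by omega) (by rw [hR]; omega) (by omega) hBz
    (weightSubgroup_le_depthSubgroup m hB2) hzw hoff
  rw [← hBz] at hc1 hc2
  rw [← hM'] at hw
  obtain ⟨E, hE1, hE2, hE3⟩ := exists_approx (n := n' + 1) (K := p ^ r * (j + a))
    (fun k _ s => hasLeading hp2 k (n' + 1) s) hw
  rw [hM'] at hE2
  have hmem : ∀ N ≤ p ^ r * (j + a), p ^ r ∣ N → N ∈ weightSet p r (r + 1) M := by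
    intro N hN hqN
    refine ⟨r, Nat.lt_succ_self r, hqN, lt_of_le_of_lt hN ?_⟩
    rw [hR]
    exact Nat.mul_lt_mul_of_pos_left (by omega) hq
  have hcoeff : ∀ N ≤ p ^ r * (j + a), p ^ r ∣ N →
      logCoeff (E⁻¹ * ⁅B, basicElement p r a 0⁆) N = logCoeff ⁅B, basicElement p r a 0⁆ N := by
    intro N hN hqN
    rw [logCoeff_mul_of_vanishing (S := weightSet p r (r + 1) M)
      (hS := isStepLower_weightSet le_rfl M) _ (inv_mem hE2), inv_mem hE2 N (hmem N hN hqN),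
      add_zero]
    intro w i _ h
    exact (isStepLower_weightSet le_rfl M).mem (hmem N hN hqN) h
  refine ⟨E⁻¹ * ⁅B, basicElement p r a 0⁆, mul_mem (inv_mem (gamma_antitone (by omega) hE1))
    (commutator_mem_gamma hB1 _), fun N hN => ?_, ?_⟩
  · have hN' : N < p ^ r * (j + a) := hN
    by_cases hqN : p ^ r ∣ N
    · rw [hcoeff N hN'.le hqN, hc1 N hN' hqN]
    · exact mem_offClass.1 hE3 N hN' hqN
  · rw [hcoeff _ le_rfl (Dvd.intro _ rfl), hc2]
    exact hja

/-- All sufficiently large multiples of `p ^ r` are depths of elements of the terms of the lower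
central series. -/
theorem exists_leading_multiple (hp2 : p ≠ 2) (hr : 1 ≤ r) {n u : ℕ}
    (hu : refWeight p r n + (r + 2) * p ^ r + 1 ≤ u) :
    ∃ C ∈ gamma p r (n + 1), C ∈ depthSubgroup p r (p ^ r * u) ∧ logCoeff C (p ^ r * u) ≠ 0 := by
  obtain ⟨n', h1, h2, h3⟩ := exists_refWeight_le (p := p) (r := r) (n₀ := n)
    (x := u - ((r + 2) * p ^ r + 1)) (by omega)
  have e : (r + 3) * p ^ r = (r + 2) * p ^ r + p ^ r := by ring
  rw [refWeight_succ] at h3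
  obtain ⟨C, hC1, hC2⟩ := exists_leading_multiple_of_le (n := n') (u := u) hp2 hr (by omega)
    (by omega)
  exact ⟨C, gamma_antitone (by omega) hC1, hC2⟩

end Fesenko
end

noncomputable section

open PowerSeries
open scoped commutatorElement

namespace Fesenko

/-! ### Indices -/

theorem relIndex_le_of_cover {G : Type*} [Group G] {H K : Subgroup G} {n : ℕ} (f : Fin n → K)
    (hf : ∀ x : K, ∃ i, ((f i : G))⁻¹ * x ∈ H) : H.relIndex K ≠ 0 ∧ H.relIndex K ≤ n := by
  let g : Fin n → K ⧸ H.subgroupOf K := fun i => QuotientGroup.mk (f i)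
  have hg : Function.Surjective g := by
    intro y
    obtain ⟨x, rfl⟩ := QuotientGroup.mk_surjective y
    obtain ⟨i, hi⟩ := hf x
    refine ⟨i, QuotientGroup.eq.2 ?_⟩
    rw [Subgroup.mem_subgroupOf]
    exact hi
  have hfin : Finite (K ⧸ H.subgroupOf K) := Finite.of_surjective g hg
  refine ⟨Subgroup.index_ne_zero_of_finite, ?_⟩
  have := Nat.card_le_card_of_surjective g hg
  rwa [Nat.card_fin] at this

variable {p r : ℕ} [hp : Fact p.Prime]

instance : CompactSpace (fesenkoGroup p r) :=
  isCompact_iff_compactSpace.1 (isClosed_fesenkoGroup p r).isCompact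

theorem eq_one_of_mem_depthSubgroup {f : fesenkoGroup p r}
    (h : ∀ L, f ∈ depthSubgroup p r L) : f = 1 := by
  refine ext_unitSeries ?_
  rw [unitSeries_one, ← sub_eq_zero]
  ext n
  exact X_pow_dvd_iff.1 (mem_depthSubgroup_iff_dvd.1 (h (n + 1))) n (Nat.lt_succ_self n)

/-- A closed set contains every element which it approximates to arbitrary depth. -/
theorem mem_of_approx {F : Set (fesenkoGroup p r)} (hF : IsClosed F) {t : fesenkoGroup p r}
    (h : ∀ L, ∃ f ∈ F, f⁻¹ * t ∈ depthSubgroup p r L) : t ∈ F := by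
  have hcont : Continuous fun f : fesenkoGroup p r => f⁻¹ * t :=
    (continuous_inv (G := fesenkoGroup p r)).mul continuous_const
  let S : ℕ → Set (fesenkoGroup p r) := fun L =>
    F ∩ (fun f : fesenkoGroup p r => f⁻¹ * t) ⁻¹' (depthSubgroup p r L : Set (fesenkoGroup p r))
  have hclosed : ∀ L, IsClosed (S L) := fun L =>
    hF.inter ((Subgroup.isClosed_of_isOpen _ (isOpen_depthSubgroup L)).preimage hcont)
  have hanti : ∀ L, S (L + 1) ⊆ S L := fun L =>
    Set.inter_subset_inter_right F
      (Set.preimage_mono (SetLike.coe_subset_coe.2 (depthSubgroup_antitone (Nat.le_succ L))))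
  have hne : ∀ L, (S L).Nonempty := fun L => by
    obtain ⟨f, h1, h2⟩ := h L
    exact ⟨f, h1, h2⟩
  obtain ⟨f, hf⟩ := IsCompact.nonempty_iInter_of_sequence_nonempty_isCompact_isClosed S
    hanti hne (hclosed 0).isCompact hclosed
  rw [Set.mem_iInter] at hf
  have h1 : f⁻¹ * t = 1 := eq_one_of_mem_depthSubgroup (f := f⁻¹ * t) fun L =>
    Set.mem_preimage.1 (hf L).2
  rw [← inv_mul_eq_one.1 h1]
  exact (hf 0).1

/-- `k` is the depth of an element of `H`. -/
def HasDepth (H : Subgroup (fesenkoGroup p r)) (k : ℕ) : Prop :=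
  ∃ C ∈ H, C ∈ depthSubgroup p r k ∧ logCoeff C k ≠ 0

theorem HasDepth.pos {H : Subgroup (fesenkoGroup p r)} {k : ℕ} (h : HasDepth H k) : k ≠ 0 := by
  obtain ⟨C, -, -, h0⟩ := h
  rintro rfl
  exact h0 (logCoeff_zero C)

theorem mem_depthSubgroup_succ {k : ℕ} {f : fesenkoGroup p r} (h : f ∈ depthSubgroup p r k)
    (h0 : logCoeff f k = 0) : f ∈ depthSubgroup p r (k + 1) := fun i hi => by
  rcases Nat.lt_succ_iff_lt_or_eq.1 hi with h1 | rfl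
  · exact h i h1
  · exact h0

theorem exists_pow_mem_depthSubgroup_succ {k : ℕ} (hk : k ≠ 0) {C f : fesenkoGroup p r}
    (hC : C ∈ depthSubgroup p r k) (hC0 : logCoeff C k ≠ 0) (hf : f ∈ depthSubgroup p r k) :
    ∃ c < p, (C ^ c)⁻¹ * f ∈ depthSubgroup p r (k + 1) := by
  have h1 : ∀ w n, 1 ≤ w → k = n + p ^ r * w → n ∈ Set.Iio k := fun w n hw h => by
    have := Nat.mul_pos (q_pos p r) hw
    exact show n < k by omega
  have h2 : ∀ n, k = p * n → n ∈ Set.Iio k := fun n h => by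
    have hn : n ≠ 0 := by
      rintro rfl
      exact hk (by simpa using h)
    have := hp.out.two_le
    have h3 : n < p * n := by nlinarith [Nat.pos_of_ne_zero hn]
    exact show n < k by omega
  obtain ⟨c, hc⟩ := exists_pow_cancel h1 h2 hf hC hC0
  have htor : p • logCoeff C k = 0 := by
    have := prime_smul_logCoeff_of_vanishing h2 hC
    rwa [natCast_zsmul] at this
  -- The leading coefficient is p-torsion, so the exponent matters only mod p.
  refine ⟨c % p, Nat.mod_lt c hp.out.pos,
    mem_depthSubgroup_succ (mul_mem (inv_mem (pow_mem hC _)) hf) ?_⟩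
  rw [logCoeff_mul_of_vanishing h1 (inv_mem (pow_mem hC _)),
    logCoeff_inv_of_vanishing h1 (pow_mem hC _), logCoeff_pow_of_vanishing h1 hC] at hc ⊢
  rw [← Nat.mod_add_div c p, add_nsmul, mul_comm, mul_nsmul', htor, smul_zero, add_zero] at hc
  exact hc

/-- Successive cancellation of leading coefficients approximates any deep element by elements of H,
and H is closed. -/
theorem depthSubgroup_le_of_hasDepth {H : Subgroup (fesenkoGroup p r)}
    (hH : IsClosed (H : Set (fesenkoGroup p r))) {K : ℕ} (h : ∀ k ≥ K, HasDepth H k) :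
    depthSubgroup p r K ≤ H := by
  intro t ht
  refine mem_of_approx hH fun L => ?_
  rcases le_total L K with hLK | hKL
  · exact ⟨1, one_mem H, by simpa using depthSubgroup_antitone hLK ht⟩
  induction L, hKL using Nat.le_induction with
  | base => exact ⟨1, one_mem H, by simpa using ht⟩
  | succ L hL ih =>
    obtain ⟨f, hf, hft⟩ := ih
    obtain ⟨C, hC1, hC2, hC3⟩ := h L hL
    obtain ⟨c, -, hc⟩ := exists_pow_mem_depthSubgroup_succ (h L hL).pos hC2 hC3 hft
    refine ⟨f * C ^ c, mul_mem hf (pow_mem hC1 c), ?_⟩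
    rw [mul_inv_rev, mul_assoc]
    exact hc

/-- The index of `H` in `G` is bounded by the number of depths of `G` which are not depths
of `H`. -/
theorem relIndex_le_of_depths {H G : Subgroup (fesenkoGroup p r)} [H.Normal] (hHG : H ≤ G)
    (hH : IsClosed (H : Set (fesenkoGroup p r))) (M : Finset ℕ)
    {K : ℕ} (hK : ∀ k ≥ K, HasDepth H k)
    (hM : ∀ k, HasDepth G k → HasDepth H k ∨ k ∈ M) :
    H.relIndex G ≠ 0 ∧ H.relIndex G ≤ p ^ M.card := by
  -- Filter G by J_k = (H·D_k) ∩ G, with D_k the depth subgroups. The step from J_k to J_(k+1) has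
  -- index 1 unless k is a depth of G and not of H, and then at most p. At k = K the chain has
  -- reached H.
  have key : ∀ k, ((H ⊔ depthSubgroup p r k) ⊓ G).relIndex G ≠ 0 ∧
      ((H ⊔ depthSubgroup p r k) ⊓ G).relIndex G ≤ p ^ (M.filter (· < k)).card := by
    intro k
    induction k with
    | zero =>
      have h0 : depthSubgroup p r 0 = ⊤ := eq_top_iff.2 fun f _ n hn => absurd hn (Nat.not_lt_zero n)
      rw [h0, sup_top_eq, top_inf_eq, Subgroup.relIndex_self]
      exact ⟨one_ne_zero, Nat.one_le_pow _ _ hp.out.pos⟩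
    | succ k ih =>
      set J := (H ⊔ depthSubgroup p r k) ⊓ G with hJ
      set J' := (H ⊔ depthSubgroup p r (k + 1)) ⊓ G with hJ'
      have hle : J' ≤ J := inf_le_inf_right _ (sup_le_sup_left
        (depthSubgroup_antitone (Nat.le_succ k)) _)
      have hJG : J ≤ G := inf_le_right
      have hdecomp : ∀ x ∈ J, ∃ h ∈ H, ∃ t ∈ depthSubgroup p r k, t ∈ G ∧ h * t = x := by
        rintro x ⟨hx, hxG⟩
        obtain ⟨h, hh, t, ht, rfl⟩ := Subgroup.mem_sup_of_normal_left.1 hx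
        refine ⟨h, hh, t, ht, ?_, rfl⟩
        have := mul_mem (inv_mem (hHG hh)) hxG
        rwa [inv_mul_cancel_left] at this
      have hmem : ∀ {t}, t ∈ depthSubgroup p r (k + 1) → t ∈ G → t ∈ J' := fun ht htG =>
        ⟨Subgroup.mem_sup_right ht, htG⟩
      have hmemH : ∀ {h}, h ∈ H → h ∈ J' := fun hh => ⟨Subgroup.mem_sup_left hh, hHG hh⟩
      have hstep : J'.relIndex J ≠ 0 ∧
          J'.relIndex J ≤ if k ∈ M then p else 1 := by
        by_cases hGk : HasDepth G k
        · rcases hM k hGk with ⟨C, hC1, hC2, hC3⟩ | hkM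
          · have h1 : J'.relIndex J = 1 := by
              rw [Subgroup.relIndex_eq_one]
              intro x hx
              obtain ⟨h, hh, t, ht, htG, rfl⟩ := hdecomp x hx
              obtain ⟨c, -, hc⟩ := exists_pow_mem_depthSubgroup_succ hGk.pos hC2 hC3 ht
              have h2 : h * t = h * C ^ c * ((C ^ c)⁻¹ * t) := by group
              rw [h2]
              exact mul_mem (hmemH (mul_mem hh (pow_mem hC1 c)))
                (hmem hc (mul_mem (inv_mem (hHG (pow_mem hC1 c))) htG))
            rw [h1]
            refine ⟨one_ne_zero, ?_⟩
            split_ifs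
            · exact hp.out.one_lt.le
            · exact le_rfl
          · rw [if_pos hkM]
            obtain ⟨C, hC1, hC2, hC3⟩ := hGk
            refine relIndex_le_of_cover
              (fun i : Fin p => ⟨C ^ (i : ℕ), Subgroup.mem_sup_right (pow_mem hC2 _),
                pow_mem hC1 _⟩) ?_
            rintro ⟨x, hx⟩
            obtain ⟨h, hh, t, ht, htG, rfl⟩ := hdecomp x hx
            have hk0 : k ≠ 0 := by
              rintro rfl
              exact hC3 (logCoeff_zero C)
            obtain ⟨c, hcp, hc⟩ := exists_pow_mem_depthSubgroup_succ hk0 hC2 hC3 ht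
            refine ⟨⟨c, hcp⟩, ?_⟩
            have h2 : (C ^ c)⁻¹ * (h * t) =
                ((C ^ c)⁻¹ * h * ((C ^ c)⁻¹)⁻¹) * ((C ^ c)⁻¹ * t) := by group
            change (C ^ c)⁻¹ * (h * t) ∈ J'
            rw [h2]
            exact mul_mem (hmemH (Subgroup.Normal.conj_mem inferInstance h hh _))
              (hmem hc (mul_mem (inv_mem (pow_mem hC1 c)) htG))
        · have h1 : J'.relIndex J = 1 := by
            rw [Subgroup.relIndex_eq_one]
            intro x hx
            obtain ⟨h, hh, t, ht, htG, rfl⟩ := hdecomp x hx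
            refine mul_mem (hmemH hh) (hmem (mem_depthSubgroup_succ ht ?_) htG)
            by_contra h0
            exact hGk ⟨t, htG, ht, h0⟩
          rw [h1]
          refine ⟨one_ne_zero, ?_⟩
          split_ifs
          · exact hp.out.one_lt.le
          · exact le_rfl
      rw [← Subgroup.relIndex_mul_relIndex J' J G hle hJG]
      refine ⟨mul_ne_zero hstep.1 ih.1, ?_⟩
      by_cases hkM : k ∈ M
      · rw [if_pos hkM] at hstep
        have hcard : (M.filter (· < k + 1)).card = (M.filter (· < k)).card + 1 := by
          have : M.filter (· < k + 1) = insert k (M.filter (· < k)) := by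
            ext i
            simp only [Finset.mem_filter, Finset.mem_insert]
            constructor
            · rintro ⟨h1, h2⟩
              by_cases hik : i = k
              · exact Or.inl hik
              · exact Or.inr ⟨h1, by omega⟩
            · rintro (rfl | ⟨h1, h2⟩)
              · exact ⟨hkM, Nat.lt_succ_self _⟩
              · exact ⟨h1, by omega⟩
          rw [this, Finset.card_insert_of_notMem (by simp)]
        rw [hcard, pow_succ']
        exact Nat.mul_le_mul hstep.2 ih.2
      · rw [if_neg hkM] at hstep
        have hsub : M.filter (· < k) ⊆ M.filter (· < k + 1) := by
          intro i hi
          simp only [Finset.mem_filter] at hi ⊢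
          exact ⟨hi.1, by omega⟩
        calc J'.relIndex J * J.relIndex G ≤ 1 * p ^ (M.filter (· < k)).card :=
              Nat.mul_le_mul hstep.2 ih.2
          _ ≤ p ^ (M.filter (· < k + 1)).card := by
              rw [one_mul]
              exact Nat.pow_le_pow_right hp.out.pos (Finset.card_le_card hsub)
  obtain ⟨h1, h2⟩ := key K
  have h3 : (H ⊔ depthSubgroup p r K) ⊓ G = H := by
    rw [sup_eq_left.2 (depthSubgroup_le_of_hasDepth hH hK), inf_eq_left.2 hHG]
  rw [h3] at h1 h2
  exact ⟨h1, h2.trans (Nat.pow_le_pow_right hp.out.pos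
    (Finset.card_le_card (Finset.filter_subset _ _)))⟩

/-! ### Depths of the terms of the lower central series -/

/-- A leading element off the multiples of q is also zero at the multiples below k: its weight
ensures this up to q(w - rq), w the reference weight, which exceeds k as s ≤ r - 1 and p ≥ 3. -/
theorem hasDepth_gamma_of_not_dvd (hp2 : p ≠ 2) {n s k : ℕ} (hs : s < r) (hk : p ^ s ∣ k)
    (hk' : ¬ p ^ (s + 1) ∣ k) (hle : p ^ s * refWeight p r n ≤ k) : HasDepth (gamma p r n) k := by
  have hps : 0 < p ^ s := pow_pos hp.out.pos s
  obtain ⟨k₀, rfl⟩ := hk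
  have hp3 : 3 ≤ p := by
    have := hp.out.two_le
    omega
  obtain ⟨n', h1, h2, h3⟩ := exists_refWeight_le (p := p) (r := r)
    (Nat.le_of_mul_le_mul_left hle hps)
  obtain ⟨C, hC1, hC2, hC3, hC4⟩ := hasLeading hp2 _ n' s hs (Dvd.intro _ rfl) hk'
    (Nat.mul_le_mul_left _ ((Nat.sub_le _ _).trans h2))
  refine ⟨C, gamma_antitone h1 hC1, fun i hi => ?_, hC4⟩
  have hi' : i < p ^ s * k₀ := hi
  by_cases hqi : p ^ r ∣ i
  · refine mem_weightSubgroup.1 hC2 r le_rfl i hqi (lt_of_lt_of_le hi' ?_)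
    have hw := le_refWeight (p := p) (r := r) n'
    rw [refWeight_succ] at h3
    have e3 : 2 * r * p ^ r = 2 * (r * p ^ r) := by ring
    obtain ⟨t, ht⟩ : ∃ t, r = t + 1 := ⟨r - 1, by omega⟩
    calc p ^ s * k₀ ≤ p ^ t * (p * (refWeight p r n' - r * p ^ r)) := by
          refine Nat.mul_le_mul (Nat.pow_le_pow_right hp.out.pos (by omega)) ?_
          have h4 : 3 * (refWeight p r n' - r * p ^ r) ≤ p * (refWeight p r n' - r * p ^ r) :=
            Nat.mul_le_mul_right _ hp3
          have h5 : p ^ r ≤ r * p ^ r := Nat.le_mul_of_pos_left _ (by omega)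
          omega
      _ = p ^ r * (refWeight p r n' - r * p ^ r) := by
          rw [← mul_assoc, ← pow_succ, ← ht]
  · exact mem_offClass.1 hC3 i hi' hqi

/-- The level of an exponent: its valuation, but at most `r`. -/
theorem exists_level (k : ℕ) : ∃ e ≤ r, p ^ e ∣ k ∧ (e < r → ¬ p ^ (e + 1) ∣ k) := by
  by_cases h : p ^ r ∣ k
  · exact ⟨r, le_rfl, h, fun h' => absurd h' (lt_irrefl r)⟩
  · obtain ⟨s, hs, h1, h2⟩ := exists_valuation h
    exact ⟨s, hs.le, h1, fun _ => h2⟩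

theorem hasDepth_gamma (hp2 : p ≠ 2) (hr : 1 ≤ r) {n e k : ℕ} (he : e ≤ r) (hk : p ^ e ∣ k)
    (hk' : e < r → ¬ p ^ (e + 1) ∣ k)
    (hle : p ^ e * (refWeight p r n + (r + 2) * p ^ r + 1) ≤ k) :
    HasDepth (gamma p r (n + 1)) k := by
  rcases he.lt_or_eq with he | rfl
  · refine hasDepth_gamma_of_not_dvd hp2 he hk (hk' he)
      ((Nat.mul_le_mul_left _ ?_).trans hle)
    have : p ^ r ≤ (r + 2) * p ^ r := Nat.le_mul_of_pos_left _ (by omega)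
    rw [refWeight_succ]
    omega
  · obtain ⟨u, rfl⟩ := hk
    exact exists_leading_multiple hp2 hr (Nat.le_of_mul_le_mul_left hle (q_pos p e))

theorem hasBoundedIndices_gamma (hp2 : p ≠ 2) (hr : 1 ≤ r) :
    HasBoundedIndices (gamma p r) := by
  -- At level e the undecided exponents run from p^e(m - eq) to p^e·T, and T - m = 3rq + 4q + 1;
  -- adding eq ≤ rq gives the factor (4r+4)q + 1.
  refine ⟨p ^ ∑ e ∈ Finset.range (r + 1), p ^ e * ((4 * r + 4) * p ^ r + 1), fun n => ?_⟩
  set T := refWeight p r n + (r + 2) * p ^ r + 1 with hT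
  set m := 1 + n * p ^ r with hm
  let M : Finset ℕ := (Finset.range (r + 1)).biUnion fun e =>
    Finset.Ico (p ^ e * (m - e * p ^ r)) (p ^ e * T)
  have hlow : ∀ k e, e ≤ r → p ^ e ∣ k → (e < r → ¬ p ^ (e + 1) ∣ k) → p ^ e * T ≤ k →
      HasDepth (gamma p r (n + 1)) k := fun k e he h1 h2 h3 => hasDepth_gamma hp2 hr he h1 h2 h3
  obtain ⟨h1, h2⟩ := relIndex_le_of_depths (gamma_succ_le (p := p) (r := r) n)
    (isClosed_gamma (n + 1)) M (K := p ^ r * T) (fun k hk => by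
      obtain ⟨e, he, h1, h2⟩ := exists_level (p := p) (r := r) k
      exact hlow k e he h1 h2
        ((Nat.mul_le_mul_right _ (Nat.pow_le_pow_right hp.out.pos he)).trans hk))
    (fun k hk => by
      obtain ⟨e, he, h1, h2⟩ := exists_level (p := p) (r := r) k
      by_cases h3 : p ^ e * T ≤ k
      · exact Or.inl (hlow k e he h1 h2 h3)
      · refine Or.inr (Finset.mem_biUnion.2 ⟨e, Finset.mem_range.2 (by omega),
          Finset.mem_Ico.2 ⟨?_, by omega⟩⟩)
        obtain ⟨C, hC1, -, hC3⟩ := hk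
        by_contra! h4
        exact hC3 (mem_weightSubgroup.1 (gamma_le_weightSubgroup n hC1) e he k h1 h4))
  refine ⟨h1, h2.trans (Nat.pow_le_pow_right hp.out.pos ?_)⟩
  refine Finset.card_biUnion_le.trans (Finset.sum_le_sum fun e he => ?_)
  rw [Nat.card_Ico, ← Nat.mul_sub]
  refine Nat.mul_le_mul_left _ ?_
  have he' : e * p ^ r ≤ r * p ^ r :=
    Nat.mul_le_mul_right _ (Nat.lt_succ_iff.1 (Finset.mem_range.1 he))
  have e1 : T = m + (3 * (r * p ^ r) + 4 * p ^ r) + 1 := by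
    rw [hT, hm, refWeight]
    ring
  have e2 : (4 * r + 4) * p ^ r = 4 * (r * p ^ r) + 4 * p ^ r := by ring
  rw [e1, e2]
  omega

end Fesenko
end

noncomputable section

open PowerSeries
open scoped commutatorElement

namespace Fesenko

/-! ### Products of commutators with fixed entries -/

section CommutatorProducts

variable {G : Type*} [Group G] {d : ℕ}

/-- The product `[ν₁, x₁] ⋯ [ν_d, x_d]`. -/
def commutatorProd (x ν : Fin d → G) : G :=
  ((List.finRange d).map fun i => ⁅ν i, x i⁆).prod

theorem commutatorProd_one (x : Fin d → G) : commutatorProd x 1 = 1 := by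
  simp [commutatorProd]

theorem map_commutatorProd {G' : Type*} [Group G'] (φ : G →* G') (x ν : Fin d → G) :
    φ (commutatorProd x ν) = commutatorProd (φ ∘ x) (φ ∘ ν) := by
  simp only [commutatorProd, map_list_prod, List.map_map]
  congr 2
  ext i
  simp [map_commutatorElement]

theorem commutatorProd_mulSingle (x : Fin d → G) (i : Fin d) (h : G) :
    commutatorProd x (Pi.mulSingle i h) = ⁅h, x i⁆ := by
  rw [commutatorProd, List.prod_map_eq_pow_single i]
  · rw [List.count_eq_one_of_mem (List.nodup_finRange d) (List.mem_finRange i), pow_one,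
      Pi.mulSingle_eq_same]
  · intro j hj _
    rw [Pi.mulSingle_eq_of_ne hj, commutatorElement_one_left]

theorem commutatorProd_mul_of_commute {x ν ζ : Fin d → G} (h : ∀ i y, Commute ⁅ζ i, x i⁆ y) :
    commutatorProd x (ν * ζ) = commutatorProd x ν * commutatorProd x ζ := by
  unfold commutatorProd
  induction List.finRange d with
  | nil => simp
  | cons i l ih =>
    have h1 : ⁅ν i * ζ i, x i⁆ = ⁅ν i, x i⁆ * ⁅ζ i, x i⁆ := by
      rw [commutatorElement_mul_left_eq_conj_mul, ← (h i (ν i)).eq, mul_inv_cancel_right,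
        (h i _).eq]
    rw [List.map_cons, List.map_cons, List.map_cons, List.prod_cons, List.prod_cons,
      List.prod_cons, ih, Pi.mul_apply, h1, mul_assoc, mul_assoc, ← mul_assoc ⁅ζ i, x i⁆,
      (h i _).eq, mul_assoc]

theorem commutatorProd_mem {H : Subgroup G} {x ν : Fin d → G} (hν : ∀ i, ν i ∈ H) :
    commutatorProd x ν ∈ ⁅H, (⊤ : Subgroup G)⁆ := by
  refine list_prod_mem fun y hy => ?_
  obtain ⟨i, -, rfl⟩ := List.mem_map.1 hy
  exact Subgroup.commutator_mem_commutator (hν i) (Subgroup.mem_top _)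

/-- Modulo [[H,G],G] the commutators [ζ_i, x_i] are central, so the product is multiplicative in its
entries. -/
theorem commutatorProd_mul (H : Subgroup G) [H.Normal] (x ν : Fin d → G) {ζ : Fin d → G}
    (hζ : ∀ i, ζ i ∈ H) :
    (commutatorProd x (ν * ζ))⁻¹ * (commutatorProd x ν * commutatorProd x ζ) ∈
      ⁅⁅H, (⊤ : Subgroup G)⁆, (⊤ : Subgroup G)⁆ := by
  set R := ⁅⁅H, (⊤ : Subgroup G)⁆, (⊤ : Subgroup G)⁆ with hR
  let π := QuotientGroup.mk' R
  rw [← QuotientGroup.eq]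
  change π _ = π _
  rw [map_mul, map_commutatorProd, map_commutatorProd, map_commutatorProd]
  have h1 : (π ∘ (ν * ζ) : Fin d → G ⧸ R) = (π ∘ ν) * (π ∘ ζ) := by
    ext i
    simp
  rw [h1]
  refine commutatorProd_mul_of_commute fun i y => ?_
  obtain ⟨g, rfl⟩ := QuotientGroup.mk'_surjective R y
  rw [← commutatorElement_eq_one_iff_commute]
  change ⁅⁅π (ζ i), π (x i)⁆, π g⁆ = 1
  rw [← map_commutatorElement, ← map_commutatorElement]
  exact (QuotientGroup.eq_one_iff _).2 (Subgroup.commutator_mem_commutator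
    (Subgroup.commutator_mem_commutator (hζ i) (Subgroup.mem_top _)) (Subgroup.mem_top _))

/-- The three subgroups lemma, applied modulo the right-hand side. -/
theorem commutator_commutator_top_le (H : Subgroup G) [H.Normal] :
    ⁅H, ⁅(⊤ : Subgroup G), (⊤ : Subgroup G)⁆⁆ ≤ ⁅⁅H, (⊤ : Subgroup G)⁆, (⊤ : Subgroup G)⁆ := by
  set R := ⁅⁅H, (⊤ : Subgroup G)⁆, (⊤ : Subgroup G)⁆ with hR
  let π := QuotientGroup.mk' R
  have h0 : ⁅⁅H.map π, (⊤ : Subgroup G).map π⁆, (⊤ : Subgroup G).map π⁆ = ⊥ := by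
    rw [← Subgroup.map_commutator, ← Subgroup.map_commutator, ← hR, QuotientGroup.map_mk'_self]
  have h1 : ⁅⁅(⊤ : Subgroup G).map π, (⊤ : Subgroup G).map π⁆, H.map π⁆ = ⊥ := by
    refine Subgroup.commutator_commutator_eq_bot_of_rotate ?_ h0
    rw [Subgroup.commutator_comm ((⊤ : Subgroup G).map π) (H.map π)]
    exact h0
  rw [← Subgroup.map_commutator, ← Subgroup.map_commutator, Subgroup.map_eq_bot_iff,
    QuotientGroup.ker_mk'] at h1
  rwa [Subgroup.commutator_comm H]

/-- Modulo [[H,G],G] the commutator [h,g] depends on g only modulo [G,G], so g may be replaced by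
some x_i; multiplicativity in the entries handles products and inverses. -/
theorem exists_commutatorProd_step (H : Subgroup G) [H.Normal] {x : Fin d → G}
    (hx : ∀ g, ∃ i, (x i)⁻¹ * g ∈ ⁅(⊤ : Subgroup G), (⊤ : Subgroup G)⁆) {u : G}
    (hu : u ∈ ⁅H, (⊤ : Subgroup G)⁆) :
    ∃ ζ : Fin d → G, (∀ i, ζ i ∈ H) ∧
      (commutatorProd x ζ)⁻¹ * u ∈ ⁅⁅H, (⊤ : Subgroup G)⁆, (⊤ : Subgroup G)⁆ := by
  rw [Subgroup.commutator_def] at hu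
  have hmul : ∀ {u v : G},
      (∃ ζ : Fin d → G, (∀ i, ζ i ∈ H) ∧
        (commutatorProd x ζ)⁻¹ * u ∈ ⁅⁅H, (⊤ : Subgroup G)⁆, (⊤ : Subgroup G)⁆) →
      (∃ ζ : Fin d → G, (∀ i, ζ i ∈ H) ∧
        (commutatorProd x ζ)⁻¹ * v ∈ ⁅⁅H, (⊤ : Subgroup G)⁆, (⊤ : Subgroup G)⁆) →
      ∃ ζ : Fin d → G, (∀ i, ζ i ∈ H) ∧
        (commutatorProd x ζ)⁻¹ * (u * v) ∈ ⁅⁅H, (⊤ : Subgroup G)⁆, (⊤ : Subgroup G)⁆ := by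
    rintro u v ⟨ν, hν, hu⟩ ⟨ζ, hζ, hv⟩
    refine ⟨ν * ζ, fun i => mul_mem (hν i) (hζ i), ?_⟩
    rw [← QuotientGroup.eq] at hu hv ⊢
    have h := QuotientGroup.eq.2 (commutatorProd_mul H x ν hζ)
    rw [h, QuotientGroup.mk_mul, QuotientGroup.mk_mul, hu, hv]
  induction hu using Subgroup.closure_induction with
  | mem u hu =>
    obtain ⟨h, hh, g, -, rfl⟩ := hu
    obtain ⟨i, hi⟩ := hx g
    refine ⟨Pi.mulSingle i h, fun j => ?_, ?_⟩
    · rcases eq_or_ne j i with rfl | hj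
      · rwa [Pi.mulSingle_eq_same]
      · rw [Pi.mulSingle_eq_of_ne hj]
        exact one_mem H
    · rw [commutatorProd_mulSingle]
      have h1 : ⁅h, g⁆ = ⁅h, x i⁆ * (x i * ⁅h, (x i)⁻¹ * g⁆ * (x i)⁻¹) := by
        rw [← mul_assoc, ← mul_assoc, ← commutatorElement_mul_right_eq_mul_conj,
          mul_inv_cancel_left]
      rw [h1, inv_mul_cancel_left]
      exact Subgroup.Normal.conj_mem inferInstance _
        (commutator_commutator_top_le H (Subgroup.commutator_mem_commutator hh hi)) _
  | one => exact ⟨1, fun _ => one_mem H, by simp [commutatorProd_one]⟩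
  | mul u v _ _ hu hv => exact hmul hu hv
  | inv u _ hu =>
    obtain ⟨ζ, hζ, hu⟩ := hu
    refine ⟨ζ⁻¹, fun i => inv_mem (hζ i), ?_⟩
    have h := QuotientGroup.eq.2 (commutatorProd_mul H x ζ⁻¹ hζ)
    rw [inv_mul_cancel, commutatorProd_one] at h
    rw [← QuotientGroup.eq] at hu ⊢
    rw [QuotientGroup.mk_mul, hu, QuotientGroup.mk_one, eq_comm, mul_eq_one_iff_eq_inv] at h
    rw [h, QuotientGroup.mk_inv]

/-- In a nilpotent group whose abelianization is covered by `x₁, …, x_d`, every element of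
`[N, G]` is of the form `[ν₁, x₁] ⋯ [ν_d, x_d]`. -/
theorem exists_eq_commutatorProd {D : ℕ → Subgroup G} {k : ℕ} (h0 : D 0 = ⊤) (hk : D k = ⊥)
    (hD : ∀ i, ⁅D i, (⊤ : Subgroup G)⁆ ≤ D (i + 1)) {x : Fin d → G}
    (hx : ∀ g, ∃ i, (x i)⁻¹ * g ∈ ⁅(⊤ : Subgroup G), (⊤ : Subgroup G)⁆)
    (N : Subgroup G) [hN : N.Normal] {u : G} (hu : u ∈ ⁅N, (⊤ : Subgroup G)⁆) :
    ∃ ν : Fin d → G, (∀ i, ν i ∈ N) ∧ commutatorProd x ν = u := by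
  -- The error stays in [M,G] for normal M descending along D; each step replaces M by [M,G] and
  -- absorbs the correction into ν.
  have key : ∀ i, ∃ M : Subgroup G, M.Normal ∧ M ≤ N ∧ M ≤ D i ∧ ∃ ν : Fin d → G,
      (∀ i, ν i ∈ N) ∧ (commutatorProd x ν)⁻¹ * u ∈ ⁅M, (⊤ : Subgroup G)⁆ := by
    intro i
    induction i with
    | zero =>
      refine ⟨N, hN, le_rfl, h0 ▸ le_top, 1, fun _ => one_mem N, ?_⟩
      rwa [commutatorProd_one, inv_one, one_mul]
    | succ i ih =>
      obtain ⟨M, hM, hMN, hMD, ν, hν, h⟩ := ih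
      obtain ⟨ζ, hζ, h1⟩ := exists_commutatorProd_step M hx h
      refine ⟨⁅M, (⊤ : Subgroup G)⁆, inferInstance, (Subgroup.commutator_le_left M ⊤).trans hMN,
        (Subgroup.commutator_mono hMD le_rfl).trans (hD i), ν * ζ,
        fun i => mul_mem (hν i) (hMN (hζ i)), ?_⟩
      have h2 := mul_mem (commutatorProd_mul M x ν hζ) h1
      rwa [mul_assoc, mul_assoc, mul_inv_cancel_left, mul_inv_cancel_left] at h2
  obtain ⟨M, -, -, hM, ν, hν, h⟩ := key k
  refine ⟨ν, hν, ?_⟩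
  have h1 : M = ⊥ := le_bot_iff.1 (hk ▸ hM)
  rw [h1, Subgroup.commutator_bot_left, Subgroup.mem_bot, inv_mul_eq_one] at h
  exact h

end CommutatorProducts

variable {p r : ℕ} [hp : Fact p.Prime]

/-! ### Closedness of commutator subgroups and the abstract series -/

theorem exists_cover_gamma_one (hp2 : p ≠ 2) (hr : 1 ≤ r) :
    ∃ (d : ℕ) (x : Fin d → fesenkoGroup p r), ∀ g, ∃ i, (x i)⁻¹ * g ∈ gamma p r 1 := by
  obtain ⟨C, hC⟩ := hasBoundedIndices_gamma (p := p) hp2 hr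
  have h1 : (gamma p r 1).index ≠ 0 := by
    have := (hC 0).1
    rwa [show gamma p r 0 = ⊤ from rfl, Subgroup.relIndex_top_right] at this
  have hfin : Finite (fesenkoGroup p r ⧸ gamma p r 1) :=
    have : (gamma p r 1).FiniteIndex := ⟨h1⟩
    Subgroup.finite_quotient_of_finiteIndex
  obtain ⟨d, ⟨e⟩⟩ := Finite.exists_equiv_fin (fesenkoGroup p r ⧸ gamma p r 1)
  refine ⟨d, fun i => (e.symm i).out, fun g => ⟨e (QuotientGroup.mk g), ?_⟩⟩
  rw [← QuotientGroup.eq, QuotientGroup.out_eq', Equiv.symm_apply_apply]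

theorem exists_approx_of_mem_closure {H : Subgroup (fesenkoGroup p r)} {t : fesenkoGroup p r}
    (ht : t ∈ H.topologicalClosure) (K : ℕ) : ∃ h ∈ H, h⁻¹ * t ∈ depthSubgroup p r K := by
  have hcont : Continuous fun f : fesenkoGroup p r => f⁻¹ * t :=
    (continuous_inv (G := fesenkoGroup p r)).mul continuous_const
  have hopen : IsOpen ((fun f : fesenkoGroup p r => f⁻¹ * t) ⁻¹'
      (depthSubgroup p r K : Set (fesenkoGroup p r))) := (isOpen_depthSubgroup K).preimage hcont
  have ht' : t ∈ closure (H : Set (fesenkoGroup p r)) := ht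
  have hmem : t ∈ (fun f : fesenkoGroup p r => f⁻¹ * t) ⁻¹'
      (depthSubgroup p r K : Set (fesenkoGroup p r)) := by
    rw [Set.mem_preimage, inv_mul_cancel]
    exact one_mem _
  obtain ⟨h, h1, h2⟩ := mem_closure_iff.1 ht' _ hopen hmem
  exact ⟨h, h2, h1⟩

/-- A continuous image of the compact set N^d in a Hausdorff group. Fixing the second entries and
the number of factors is what makes this possible. -/
theorem isClosed_commutatorProd (N : Subgroup (fesenkoGroup p r))
    (hN : IsClosed (N : Set (fesenkoGroup p r))) {d : ℕ} (x : Fin d → fesenkoGroup p r) :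
    IsClosed (commutatorProd x '' {ν | ∀ i, ν i ∈ N}) := by
  have h1 : IsCompact (Set.univ.pi fun _ : Fin d => (N : Set (fesenkoGroup p r))) :=
    isCompact_univ_pi fun _ => hN.isCompact
  have h2 : {ν : Fin d → fesenkoGroup p r | ∀ i, ν i ∈ N} =
      Set.univ.pi fun _ => (N : Set (fesenkoGroup p r)) := by
    ext ν
    simp
  rw [h2]
  refine (h1.image ?_).isClosed
  refine continuous_list_prod _ fun i _ => ?_
  have h3 : Continuous fun ν : Fin d → fesenkoGroup p r => ν i := continuous_apply i
  have h4 : Continuous fun ν : Fin d → fesenkoGroup p r => (ν i)⁻¹ :=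
    (continuous_inv (G := fesenkoGroup p r)).comp h3
  simp only [commutatorElement_def]
  exact ((h3.mul continuous_const).mul h4).mul continuous_const

/-- The quotient by a depth subgroup is nilpotent, with central series given by the images of the
depth subgroups. There `gamma p r 1` and the abstract commutator subgroup have the same image. -/
theorem exists_commutatorProd_approx {d : ℕ} {x : Fin d → fesenkoGroup p r}
    (hx : ∀ g, ∃ i, (x i)⁻¹ * g ∈ gamma p r 1) (N : Subgroup (fesenkoGroup p r)) [N.Normal]
    {u : fesenkoGroup p r} (hu : u ∈ ⁅N, (⊤ : Subgroup (fesenkoGroup p r))⁆) (K : ℕ) :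
    ∃ ν : Fin d → fesenkoGroup p r, (∀ i, ν i ∈ N) ∧
      (commutatorProd x ν)⁻¹ * u ∈ depthSubgroup p r K := by
  let π := QuotientGroup.mk' (depthSubgroup p r K)
  have hπ : Function.Surjective π := QuotientGroup.mk'_surjective _
  have htop : (⊤ : Subgroup (fesenkoGroup p r)).map π = ⊤ := Subgroup.map_top_of_surjective π hπ
  have hker : ∀ k, K ≤ k → (depthSubgroup p r k).map π = ⊥ := fun k hk => by
    rw [Subgroup.map_eq_bot_iff, QuotientGroup.ker_mk']
    exact depthSubgroup_antitone hk
  have hD : ∀ i, ⁅(depthSubgroup p r (i + 1)).map π, ⊤⁆ ≤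
      (depthSubgroup p r (i + 1 + 1)).map π := by
    intro i
    rw [← htop, ← Subgroup.map_commutator]
    refine Subgroup.map_mono (Subgroup.commutator_le.2 fun b hb a _ => ?_)
    exact commutator_mem_depthSubgroup hb a
  have hx' : ∀ g, ∃ i, ((π ∘ x) i)⁻¹ * g ∈
      ⁅(⊤ : Subgroup (fesenkoGroup p r ⧸ depthSubgroup p r K)),
        (⊤ : Subgroup (fesenkoGroup p r ⧸ depthSubgroup p r K))⁆ := by
    intro g
    obtain ⟨g, rfl⟩ := hπ g
    obtain ⟨i, hi⟩ := hx g
    obtain ⟨h, hh, h1⟩ := exists_approx_of_mem_closure hi K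
    refine ⟨i, ?_⟩
    have h2 : π h = π ((x i)⁻¹ * g) := QuotientGroup.eq.2 h1
    rw [Function.comp_apply, ← map_inv, ← map_mul, ← h2, ← htop, ← Subgroup.map_commutator]
    exact Subgroup.mem_map_of_mem π hh
  have hN : (N.map π).Normal := Subgroup.Normal.map inferInstance π hπ
  have hu' : π u ∈ ⁅N.map π, (⊤ : Subgroup (fesenkoGroup p r ⧸ depthSubgroup p r K))⁆ := by
    rw [← htop, ← Subgroup.map_commutator]
    exact Subgroup.mem_map_of_mem π hu
  obtain ⟨ν, hν, h⟩ := exists_eq_commutatorProd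
    (D := fun i => (depthSubgroup p r (i + 1)).map π) (k := K)
    (by rw [depthSubgroup_one, htop]) (hker _ (Nat.le_succ K)) hD hx' (N.map π) hu'
  choose ν' hν' hνν' using fun i => Subgroup.mem_map.1 (hν i)
  refine ⟨ν', hν', QuotientGroup.eq.1 ?_⟩
  change π _ = π _
  rw [map_commutatorProd, ← h]
  congr 1
  exact funext hνν'

/-- Commutator subgroups with closed normal subgroups are closed. -/
theorem topologicalClosure_commutator (hp2 : p ≠ 2) (hr : 1 ≤ r)
    (N : Subgroup (fesenkoGroup p r)) [N.Normal] (hN : IsClosed (N : Set (fesenkoGroup p r))) :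
    ⁅N, (⊤ : Subgroup (fesenkoGroup p r))⁆.topologicalClosure = ⁅N, ⊤⁆ := by
  refine le_antisymm (fun t ht => ?_) (Subgroup.le_topologicalClosure _)
  obtain ⟨d, x, hx⟩ := exists_cover_gamma_one (p := p) hp2 hr
  -- An element of the closure is approximated to every depth by products of the fixed shape, hence
  -- is itself such a product and lies in the abstract commutator subgroup.
  obtain ⟨ν, hν, rfl⟩ := mem_of_approx (isClosed_commutatorProd N hN x) (t := t) fun L => by
    obtain ⟨u, hu, hut⟩ := exists_approx_of_mem_closure ht L
    obtain ⟨ν, hν, h⟩ := exists_commutatorProd_approx hx N hu L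
    refine ⟨_, ⟨ν, hν, rfl⟩, ?_⟩
    have := mul_mem h hut
    rwa [mul_assoc, mul_inv_cancel_left] at this
  exact commutatorProd_mem hν

theorem lowerCentralSeries_eq_gamma (hp2 : p ≠ 2) (hr : 1 ≤ r) :
    (⊤ : Subgroup (fesenkoGroup p r)).lowerCentralSeries = gamma p r := by
  funext n
  induction n with
  | zero => rfl
  | succ n ih =>
    have h1 : (⊤ : Subgroup (fesenkoGroup p r)).lowerCentralSeries (n + 1) =
      ⁅(⊤ : Subgroup (fesenkoGroup p r)).lowerCentralSeries n, ⊤⁆ := rfl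
    rw [h1, ih]
    exact (topologicalClosure_commutator hp2 hr (gamma p r n) (isClosed_gamma n)).symm

end Fesenko

end

theorem theorem1p1 (p r : ℕ) [Fact p.Prime] (hp : 2 < p) (hr : 1 ≤ r) :
    HasFiniteWidth (fesenkoGroup p r) ∧ HasFiniteAbstractWidth (fesenkoGroup p r) := by
  have h := Fesenko.hasBoundedIndices_gamma (p := p) (r := r) (by omega) hr
  refine ⟨h, ?_⟩
  rw [HasFiniteAbstractWidth, Fesenko.lowerCentralSeries_eq_gamma (by omega) hr]
  exact h
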